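/- A set system $(U,\mathcal F)$ consists of a finite ground set $U=\{0,\dots,N-1\}$ and a family $\mathcal F\subseteq 2^U$ of solutions with $\emptyset\in\mathcal F$. It is *strongly accessible* if for all $X,Y\in\mathcal F$ with $X\subsetneq Y$ there is $z\in Y\setminus X$ with $X\cup\{z\}\in\mathcal F$, and it is an *independence system* if every subset of a solution is a solution. A solution is maximal if no other solution properly contains it; $\alpha$ denotes the number of maximal solutions and $q$ the largest size of a solution. Algorithms are deterministic Turing machines with finitely many tapes (stacks), and time is the number of steps. A set system is given to an algorithm by $N$ and a Boolean circuit that tests whether $X\in\mathcal F$ (with wire indices in unary), of encoding length polynomial in $N$, i.e. at most $N^d+d$ for a fixed $d$. An algorithm *lists the maximal solutions of a class of set systems* if on every such input from the class it halts and has then output all maximal solutions, each exactly once. The Strong Exponential Time Hypothesis (SETH) says: for every $\delta<1$ there is a $k$ such that no algorithm decides satisfiability of $k$-CNF formulas $\varphi$ with $n$ variables in time $\mathrm{poly}(|\varphi|)\cdot 2^{\delta n}$. **Lemma.** Assume SETH. Then any algorithm that lists all $\alpha$ maximal solutions of every strongly accessible set system has worst-case time $\Omega(\alpha\, 2^{q/2})$,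 and the same holds for any algorithm that lists all maximal solutions of every independence system. Precisely, let $P$ be either of these two classes. There is an integer $d\ge 0$ such that for every algorithm $A$ that lists the maximal solutions of all systems of $P$ given by circuits of encoding length at most $N^d+d$, there is $c>0$ such that for every $q_0$ there is such a system in $P$ with $q\ge q_0$ and $N\le 2q$ on which $A$ makes at least $c\,\alpha\,2^{q/2}$ steps. -/

import Mathlib

namespace MaxListing

section SetSystems

variable {U : Type} [DecidableEq U]

/-- Independence set systems (hereditary properties): the empty set is a solution, and every
subset of a solution is a solution. -/
def IsIndependence (F : Set (Finset U)) : Prop :=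
  ∅ ∈ F ∧ ∀ X Y : Finset U, X ⊆ Y → Y ∈ F → X ∈ F

/-- Strongly accessible set systems: the empty set is a solution, and if `X ⊂ Y` are solutions
then some `z ∈ Y \ X` can be added to `X`. -/
def IsStronglyAccessible (F : Set (Finset U)) : Prop :=
  ∅ ∈ F ∧ ∀ X Y : Finset U, X ∈ F → Y ∈ F → X ⊂ Y → ∃ z ∈ Y \ X, insert z X ∈ F

/-- The maximal solutions: those that are properly contained in no other solution. -/
def maximalSolutions (F : Set (Finset U)) : Set (Finset U) :=
  {X | Maximal (fun Z => Z ∈ F) X}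

/-- The number `α` of maximal solutions (used for finite ground sets only). -/
noncomputable def numMaximal (F : Set (Finset U)) : ℕ := (maximalSolutions F).ncard

/-- The largest size `q` of a solution (used for finite ground sets only). -/
noncomputable def maxSize (F : Set (Finset U)) : ℕ := sSup (Finset.card '' F)

end SetSystems

section Machines

/-- A deterministic algorithm reading words over `Γ₀` and writing words over `Γ₁`: a
Turing machine with finitely many stacks (two stacks form a tape), finitely many labels and
finitely many internal states. -/
abbrev Algorithm (Γ₀ Γ₁ : Type) : Type 1 := Turing.TM2ComputableAux Γ₀ Γ₁

/-- Started on input `x`, the machine `A` halts after exactly `t` steps, and then the content of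
its output stack is `y`. Nothing is asked of its other stacks. -/
def Algorithm.Outputs {Γ₀ Γ₁ : Type} (A : Algorithm Γ₀ Γ₁) (x : List Γ₀) (y : List Γ₁)
    (t : ℕ) : Prop :=
  ∃ cfg : Turing.TM2.Cfg A.tm.Γ A.tm.Λ A.tm.σ,
    (fun o : Option (Turing.TM2.Cfg A.tm.Γ A.tm.Λ A.tm.σ) => o.bind (Turing.TM2.step A.tm.m))^[t]
        (some (Turing.initList A.tm (x.map A.inputAlphabet.symm))) = some cfg ∧
      cfg.l = none ∧ cfg.stk A.tm.k₁ = y.map A.outputAlphabet.symm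

end Machines

section Satisfiability

/-- A formula in conjunctive normal form over the variables `0, …, n - 1`: a list of clauses, each
of which is a list of literals; the literal `(b, i)` says that variable `i` has value `b`. -/
abbrev CNF (n : ℕ) : Type := List (List (Bool × Fin n))

def CNF.Satisfiable {n : ℕ} (φ : CNF n) : Prop :=
  ∃ v : Fin n → Bool, ∀ c ∈ φ, ∃ l ∈ c, v l.2 = l.1

/-- The clauses are pairwise distinct and have at most `k` literals each. -/
def CNF.IsKCNF {n : ℕ} (k : ℕ) (φ : CNF n) : Prop :=
  φ.Nodup ∧ ∀ c ∈ φ, c.length ≤ k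

inductive CNFSym : Type
  | tick
  | pos
  | neg
  | sep

/-- The sign of a literal, followed by the index of its variable in unary. -/
def encodeLiteral {n : ℕ} (l : Bool × Fin n) : List CNFSym :=
  (if l.1 then CNFSym.pos else CNFSym.neg) :: List.replicate (l.2 : ℕ) CNFSym.tick

/-- The number of variables in unary, then the clauses, with a terminator after each of them. -/
def encodeCNF {n : ℕ} (φ : CNF n) : List CNFSym :=
  List.replicate n CNFSym.tick ++ CNFSym.sep ::
    φ.flatMap fun c => c.flatMap encodeLiteral ++ [CNFSym.sep]

/-- Some algorithm decides whether a `k`-CNF formula `φ` with `n` variables is satisfiable in time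
`poly(|φ|) * 2 ^ (δ n)`. -/
def KSatSolvable (k : ℕ) (δ : ℝ) : Prop :=
  ∃ (M : Algorithm CNFSym Bool) (C : ℕ), ∀ (n : ℕ) (φ : CNF n), φ.IsKCNF k →
    ∃ (b : Bool) (t : ℕ), (b = true ↔ φ.Satisfiable) ∧ M.Outputs (encodeCNF φ) [b] t ∧
      (t : ℝ) ≤ C * ((encodeCNF φ).length + 1 : ℝ) ^ C * (2 : ℝ) ^ (δ * n)

/-- The Strong Exponential Time Hypothesis: for no `δ < 1` can `k`-SAT be solved in time
`poly(|φ|) * 2 ^ (δ n)` for all `k`. -/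
def SETH : Prop := ∀ δ : ℝ, δ < 1 → ∃ k : ℕ, ¬ KSatSolvable k δ

end Satisfiability

section Circuits

/-- A gate of a Boolean circuit; its arguments are the numbers of the wires that it reads. -/
inductive Gate : Type
  | and (i j : ℕ)
  | or (i j : ℕ)
  | not (i : ℕ)

/-- The value of a gate, given the values of the preceding wires. A wire that does not exist
carries the value `false`. -/
def Gate.eval (w : List Bool) : Gate → Bool
  | .and i j => w.getD i false && w.getD j false
  | .or i j => w.getD i false || w.getD j false
  | .not i => !(w.getD i false)

/-- A Boolean circuit (straight-line program) with `N` inputs. Wires `0, …, N - 1` are the inputs,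
the `i`-th gate drives wire `N + i`, and the last wire is the output. -/
structure Circuit (N : ℕ) : Type where
  gates : List Gate

def Circuit.eval {N : ℕ} (C : Circuit N) (x : Fin N → Bool) : Bool :=
  (C.gates.foldl (fun w g => w ++ [g.eval w]) (List.ofFn x)).getLastD false

/-- The set system on the ground set `{0, …, N - 1}` whose membership test is the circuit `C`. -/
def Circuit.family {N : ℕ} (C : Circuit N) : Set (Finset (Fin N)) :=
  {X | C.eval (fun i => decide (i ∈ X)) = true}

inductive CircuitSym : Type
  | tick
  | sep
  | and
  | or
  | not

def encodeGate : Gate → List CircuitSym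
  | .and i j => CircuitSym.and :: (List.replicate i CircuitSym.tick ++ CircuitSym.sep ::
      List.replicate j CircuitSym.tick)
  | .or i j => CircuitSym.or :: (List.replicate i CircuitSym.tick ++ CircuitSym.sep ::
      List.replicate j CircuitSym.tick)
  | .not i => CircuitSym.not :: List.replicate i CircuitSym.tick

/-- The size of the ground set in unary, then the gates. -/
def encodeCircuit {N : ℕ} (C : Circuit N) : List CircuitSym :=
  List.replicate N CircuitSym.tick ++ C.gates.flatMap encodeGate

end Circuits

section Listing

/-- A list of sets is written as the list of their characteristic vectors, with the terminator
`none` after each of them. -/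
def encodeSets {N : ℕ} (L : List (Finset (Fin N))) : List (Option Bool) :=
  L.flatMap fun X => List.ofFn (fun i : Fin N => some (decide (i ∈ X))) ++ [none]

/-- A set system is presented by a circuit that tests membership, and the presentation has
length at most `N ^ d + d`, where `N` is the size of the ground set. -/
def IsInstance (P : ∀ N : ℕ, Set (Finset (Fin N)) → Prop) (d N : ℕ) (C : Circuit N) : Prop :=
  P N C.family ∧ (encodeCircuit C).length ≤ N ^ d + d

/-- On every instance, `A` halts and has then listed all maximal solutions, in any order, each of
them exactly once. -/
def ListsMaximal (P : ∀ N : ℕ, Set (Finset (Fin N)) → Prop) (d : ℕ)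
    (A : Algorithm CircuitSym (Option Bool)) : Prop :=
  ∀ (N : ℕ) (C : Circuit N), IsInstance P d N C →
    ∃ (L : List (Finset (Fin N))) (t : ℕ), A.Outputs (encodeCircuit C) (encodeSets L) t ∧
      L.Nodup ∧ ∀ X, X ∈ L ↔ X ∈ maximalSolutions C.family

/-- Every algorithm that lists the maximal solutions of all systems of the class `P` takes time
`Ω(α * 2 ^ (q / 2))` in the worst case: for some `c > 0` there are instances with arbitrarily
large `q` on which it makes at least `c * α * 2 ^ (q / 2)` steps. Membership in these instances is
tested by circuits of size polynomial in the size `N` of the ground set, and `N ≤ 2 q`, so that the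
bound does not come from reading a large input or from writing down large names of elements. -/
def ListingLowerBound (P : ∀ N : ℕ, Set (Finset (Fin N)) → Prop) : Prop :=
  ∃ d : ℕ, ∀ A : Algorithm CircuitSym (Option Bool), ListsMaximal P d A →
    ∃ c : ℝ, 0 < c ∧ ∀ q₀ : ℕ, ∃ (N : ℕ) (C : Circuit N), IsInstance P d N C ∧
      q₀ ≤ maxSize C.family ∧ N ≤ 2 * maxSize C.family ∧
      ∃ (y : List (Option Bool)) (t : ℕ), A.Outputs (encodeCircuit C) y t ∧
        c * (numMaximal C.family : ℝ) * (2 : ℝ) ^ ((maxSize C.family : ℝ) / 2) ≤ (t : ℝ)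

end Listing

end MaxListing

/-! Suppose that an algorithm `A` lists the maximal solutions of all independence systems faster
than claimed whenever q is large. Then `A` yields a decision procedure for k-SAT in time poly ·
2^(19n/20), for the k that SETH supplies against δ = 19/20.

The n variables are cut into m ≈ n/3 blocks of three (some dummies included). Each block gets two
padding elements, so that its five elements have weights 1, 1, 1, 1, 2, and one last element ω is
added: N = 5m + 1. A set is a solution if some block has weight below 3 (a light block), or if all
blocks have weight exactly 3, ω is absent, and the variables satisfy the formula. Any values of
three variables can be padded to weight exactly 3. A subset of a solution of the second kind has a
light block or agrees with it outside ω, so the system is hereditary (`isIndependence_gadget`).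

A maximal solution with a light block is full outside that block. Hence it contains ω, and there are
at most 32m such sets (`numMaximal_gadget_le`). A maximal solution without ω encodes a satisfying
assignment, and every satisfying assignment gives one (`holds_of_maximal`,
`exists_maximal_of_holds`). So for an unsatisfiable formula α ≤ 32m and q ≤ 5m + 1, and the assumed
bound on the time of `A` is at most 7^m because 2^(5/2) < 6 (`mul_rpow_le_pow`). The decider runs
`A` for 7^m steps. If `A` has not halted, the formula is satisfiable; otherwise the output is
searched for a set without ω (`exists_outputs_decider`). Since 7 < 2^(57/20), this takes 2^(19n/20)
steps up to a polynomial (`pow_numBlocks_le`).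

Most of the work is to realise the decider as a Turing machine. Programs are composed from
combinators with explicit time bounds. The circuit is a straight-line simulation of three Boolean
registers held by the last three wires, so that a machine with a few unary counters can write its
gates one after the other. Independence systems are strongly accessible, so the same instances serve
both classes. -/

namespace MaxListing

open Turing

/-! ### Structured programs for stack machines: sequence and loops, with time bounds -/

section Programs

variable {K : Type} [DecidableEq K] {Γ : K → Type} {σ Λ Λ' : Type}

/-- `m` goes from the configuration `c` to the configuration `c'` in exactly `n` steps. -/
def StepsTo (m : Λ → TM2.Stmt Γ Λ σ) (n : ℕ) (c c' : TM2.Cfg Γ Λ σ) : Prop :=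
  (fun o : Option (TM2.Cfg Γ Λ σ) => o.bind (TM2.step m))^[n] (some c) = some c'

theorem StepsTo.refl (m : Λ → TM2.Stmt Γ Λ σ) (c : TM2.Cfg Γ Λ σ) : StepsTo m 0 c c := rfl

theorem StepsTo.trans {m : Λ → TM2.Stmt Γ Λ σ} {a b : ℕ} {c₁ c₂ c₃ : TM2.Cfg Γ Λ σ}
    (h₁ : StepsTo m a c₁ c₂) (h₂ : StepsTo m b c₂ c₃) : StepsTo m (a + b) c₁ c₃ := by
  unfold StepsTo at *
  rw [Nat.add_comm, Function.iterate_add_apply, h₁, h₂]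

theorem StepsTo.single (m : Λ → TM2.Stmt Γ Λ σ) (l : Λ) (v : σ) (S : ∀ k, List (Γ k)) :
    StepsTo m 1 ⟨some l, v, S⟩ (TM2.stepAux (m l) v S) := rfl

theorem iterate_bind_none {α : Type} (f : α → Option α) (n : ℕ) :
    (fun o : Option α => o.bind f)^[n] none = none := by
  induction n with
  | zero => rfl
  | succ n ih => rw [Function.iterate_succ_apply]; exact ih

theorem StepsTo.succ_iff {m : Λ → TM2.Stmt Γ Λ σ} {n : ℕ} {l : Λ} {v : σ}
    {S : ∀ k, List (Γ k)} {c : TM2.Cfg Γ Λ σ} :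
    StepsTo m (n + 1) ⟨some l, v, S⟩ c ↔ StepsTo m n (TM2.stepAux (m l) v S) c := Iff.rfl

theorem StepsTo.of_halted {m : Λ → TM2.Stmt Γ Λ σ} {n : ℕ} {v : σ}
    {S : ∀ k, List (Γ k)} {c : TM2.Cfg Γ Λ σ} (h : StepsTo m n ⟨none, v, S⟩ c) :
    n = 0 ∧ c = ⟨none, v, S⟩ := by
  cases n with
  | zero => exact ⟨rfl, (Option.some.inj h).symm⟩
  | succ n =>
    have h' : (fun o : Option (TM2.Cfg Γ Λ σ) => o.bind (TM2.step m))^[n] none = some c := h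
    rw [iterate_bind_none] at h'
    cases h'

/-- The jump to `e`; if there is no such label, the machine halts. -/
def jump : Option Λ → TM2.Stmt Γ Λ σ
  | some l => .goto fun _ => l
  | none => .halt

/-- Rename the labels by `f`, and jump to `e` instead of halting. -/
def relabel (f : Λ → Λ') (e : Option Λ') : TM2.Stmt Γ Λ σ → TM2.Stmt Γ Λ' σ
  | .push k g q => .push k g (relabel f e q)
  | .peek k g q => .peek k g (relabel f e q)
  | .pop k g q => .pop k g (relabel f e q)
  | .load g q => .load g (relabel f e q)
  | .branch g q₁ q₂ => .branch g (relabel f e q₁) (relabel f e q₂)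
  | .goto l => .goto fun v => f (l v)
  | .halt => jump e

theorem stepAux_relabel (f : Λ → Λ') (e : Option Λ') (s : TM2.Stmt Γ Λ σ) (v : σ)
    (S : ∀ k, List (Γ k)) :
    TM2.stepAux (relabel f e s) v S =
      ⟨((TM2.stepAux s v S).l.map f).or e, (TM2.stepAux s v S).var, (TM2.stepAux s v S).stk⟩ := by
  induction s generalizing v S with
  | push k g q ih => exact ih _ _
  | peek k g q ih => exact ih _ _
  | pop k g q ih => exact ih _ _
  | load g q ih => exact ih _ _
  | branch g q₁ q₂ ih₁ ih₂ =>
    simp only [relabel, TM2.stepAux]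
    cases g v
    · exact ih₂ _ _
    · exact ih₁ _ _
  | goto l => rfl
  | halt => cases e <;> rfl

theorem stepAux_relabel_of_eq (f : Λ → Λ') (e : Option Λ') {s : TM2.Stmt Γ Λ σ} {v : σ}
    {S : ∀ k, List (Γ k)} {c : TM2.Cfg Γ Λ σ} (h : TM2.stepAux s v S = c) :
    TM2.stepAux (relabel f e s) v S = ⟨(c.l.map f).or e, c.var, c.stk⟩ := by
  rw [stepAux_relabel, h]

/-- A machine that contains a renamed copy of `m` follows its run step by step. Halting becomes a
jump within the same step, so composition costs no extra time. -/
theorem StepsTo.relabel {m : Λ → TM2.Stmt Γ Λ σ} {m' : Λ' → TM2.Stmt Γ Λ' σ} {f : Λ → Λ'}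
    {e : Option Λ'} (hm : ∀ l, m' (f l) = relabel f e (m l)) {n : ℕ} {c : TM2.Cfg Γ Λ σ} {v : σ}
    {S : ∀ k, List (Γ k)} (h : StepsTo m n c ⟨none, v, S⟩) :
    StepsTo m' n ⟨(c.l.map f).or e, c.var, c.stk⟩ ⟨e, v, S⟩ := by
  induction n generalizing c with
  | zero =>
    cases Option.some.inj h
    exact StepsTo.refl _ _
  | succ n ih =>
    obtain ⟨l, u, R⟩ := c
    cases l with
    | none => exact absurd (StepsTo.of_halted h).1 (Nat.succ_ne_zero n)
    | some l =>
      refine StepsTo.succ_iff.2 ?_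
      rw [hm, stepAux_relabel]
      exact ih (StepsTo.succ_iff.1 h)

variable (Γ σ) in
/-- A program that works on the stacks `Γ` with internal states `σ`. -/
structure Prog : Type 1 where
  Λ : Type
  fin : Fintype Λ
  entry : Λ
  code : Λ → TM2.Stmt Γ Λ σ

namespace Prog

/-- Started with any internal state, the program `p` turns the stacks `S` into `S'` in at most `T`
steps. -/
def Run (p : Prog Γ σ) (S S' : ∀ k, List (Γ k)) (T : ℕ) : Prop :=
  ∀ v, ∃ v', ∃ t ≤ T, StepsTo p.code t ⟨some p.entry, v, S⟩ ⟨none, v', S'⟩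

theorem Run.mono {p : Prog Γ σ} {S S' : ∀ k, List (Γ k)} {T T' : ℕ} (h : p.Run S S' T)
    (hT : T ≤ T') : p.Run S S' T' := fun v =>
  let ⟨v', t, ht, h'⟩ := h v
  ⟨v', t, ht.trans hT, h'⟩

/-- A program that consists of a single statement. -/
def prim (s : TM2.Stmt Γ Unit σ) : Prog Γ σ := ⟨Unit, inferInstance, (), fun _ => s⟩

theorem Run.prim {s : TM2.Stmt Γ Unit σ} {S S' : ∀ k, List (Γ k)}
    (h : ∀ v, ∃ v', TM2.stepAux s v S = ⟨none, v', S'⟩) : (prim s).Run S S' 1 := fun v =>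
  let ⟨v', h'⟩ := h v
  ⟨v', 1, le_rfl, congrArg some h'⟩

/-- First `p`, then `q`. -/
def seq (p q : Prog Γ σ) : Prog Γ σ :=
  letI := p.fin
  letI := q.fin
  { Λ := p.Λ ⊕ q.Λ
    fin := inferInstance
    entry := .inl p.entry
    code := Sum.elim (fun l => relabel .inl (some (.inr q.entry)) (p.code l))
      (fun l => relabel .inr none (q.code l)) }

/-- The internal state in which `p` stops is not controlled; this is why `Run` quantifies over all
initial internal states. -/
theorem Run.seq {p q : Prog Γ σ} {S S' S'' : ∀ k, List (Γ k)} {T T' : ℕ} (hp : p.Run S S' T)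
    (hq : q.Run S' S'' T') : (p.seq q).Run S S'' (T + T') := by
  intro v
  obtain ⟨v', t, ht, h⟩ := hp v
  obtain ⟨v'', t', ht', h'⟩ := hq v'
  exact ⟨v'', t + t', Nat.add_le_add ht ht',
    (StepsTo.relabel (m' := (p.seq q).code) (f := .inl) (e := some (.inr q.entry))
      (fun _ => rfl) h).trans
    (StepsTo.relabel (m' := (p.seq q).code) (f := .inr) (e := none) (fun _ => rfl) h')⟩

/-- As long as the statement `g` jumps to some `i`, run the program `p i` and repeat. -/
def loop {ι : Type} [Fintype ι] (g : TM2.Stmt Γ ι σ) (p : ι → Prog Γ σ) : Prog Γ σ :=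
  letI := fun i => (p i).fin
  { Λ := Option (Σ i, (p i).Λ)
    fin := inferInstance
    entry := none
    code := fun l => match l with
      | none => relabel (fun i => some ⟨i, (p i).entry⟩) none g
      | some ⟨i, l⟩ => relabel (fun l => some ⟨i, l⟩) (some none) ((p i).code l) }

theorem Run.loop_exit {ι : Type} [Fintype ι] {g : TM2.Stmt Γ ι σ} {p : ι → Prog Γ σ}
    {S S' : ∀ k, List (Γ k)} (h : ∀ v, ∃ v', TM2.stepAux g v S = ⟨none, v', S'⟩) :
    (loop g p).Run S S' 1 := by
  intro v
  obtain ⟨v', h'⟩ := h v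
  exact ⟨v', 1, le_rfl, congrArg some (stepAux_relabel_of_eq _ _ h')⟩

theorem Run.loop_step {ι : Type} [Fintype ι] {g : TM2.Stmt Γ ι σ} {p : ι → Prog Γ σ}
    {S S₁ S₂ S' : ∀ k, List (Γ k)} {T T' : ℕ} (i : ι)
    (h : ∀ v, ∃ v', TM2.stepAux g v S = ⟨some i, v', S₁⟩) (hp : (p i).Run S₁ S₂ T)
    (hl : (loop g p).Run S₂ S' T') : (loop g p).Run S S' (T + T' + 1) := by
  intro v
  obtain ⟨v₁, h₁⟩ := h v
  obtain ⟨v₂, t, ht, h₂⟩ := hp v₁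
  obtain ⟨v', t', ht', h'⟩ := hl v₂
  refine ⟨v', 1 + t + t', by omega, ?_⟩
  refine StepsTo.trans (StepsTo.trans (StepsTo.single _ _ _ _) (?_ : StepsTo _ t _ _)) h'
  have h₃ := stepAux_relabel_of_eq (fun i => (some ⟨i, (p i).entry⟩ : (loop g p).Λ)) none h₁
  refine Eq.mpr (congrArg (fun c => StepsTo _ t c _) h₃) ?_
  exact StepsTo.relabel (m' := (loop g p).code) (f := fun l => some ⟨i, l⟩) (e := some none)
    (fun _ => rfl) h₂

/-- Pop symbols from the stack `k` and run the program that is selected, until none is. -/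
def popLoop {ι : Type} [Fintype ι] [Inhabited ι] (k : K) (rd : σ → Option (Γ k) → σ)
    (sel : σ → Option ι) (p : ι → Prog Γ σ) : Prog Γ σ :=
  loop (.pop k rd (.branch (fun v => (sel v).isSome) (.goto fun v => (sel v).getD default) .halt)) p

theorem Run.popLoop_nil {ι : Type} [Fintype ι] [Inhabited ι] {k : K} {rd : σ → Option (Γ k) → σ}
    {sel : σ → Option ι} {p : ι → Prog Γ σ} {S : ∀ k, List (Γ k)} (hS : S k = [])
    (h : ∀ v, sel (rd v none) = none) : (popLoop k rd sel p).Run S S 1 := by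
  refine Run.loop_exit fun v => ⟨rd v none, ?_⟩
  -- Popping an empty stack leaves it empty.
  have hS' : Function.update S k (S k).tail = S := by rw [hS, List.tail_nil, ← hS]; simp
  simp only [TM2.stepAux, hS']
  simp [hS, h]

theorem Run.popLoop_cons {ι : Type} [Fintype ι] [Inhabited ι] {k : K} {rd : σ → Option (Γ k) → σ}
    {sel : σ → Option ι} {p : ι → Prog Γ σ} {S S₁ S₂ : ∀ k, List (Γ k)} {T T' : ℕ} {a : Γ k}
    {l : List (Γ k)} {i : ι} (hS : S k = a :: l) (h : ∀ v, sel (rd v (some a)) = some i)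
    (hp : (p i).Run (Function.update S k l) S₁ T) (hl : (popLoop k rd sel p).Run S₁ S₂ T') :
    (popLoop k rd sel p).Run S S₂ (T + T' + 1) := by
  refine Run.loop_step i (fun v => ⟨rd v (some a), ?_⟩) hp hl
  simp [hS, h]

end Prog

end Programs

end MaxListing

namespace MaxListing

open Turing

/-! ### The stacks of the decider: input, output, result, unary counters, and the stacks of the
simulated machine -/

section State

/-- The counters of the machine. -/
inductive Reg : Type
  | wire
  | blocks
  | idx
  | tmp
  | clock
  | done
  deriving DecidableEq

instance : Fintype Reg :=
  ⟨{.wire, .blocks, .idx, .tmp, .clock, .done}, fun r => by cases r <;> decide⟩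

/-- The stacks of the machine, apart from those of the simulated one. -/
inductive Own : Type
  | inp
  | out
  | res
  | reg (r : Reg)
  deriving DecidableEq

instance : Fintype Own :=
  ⟨{.inp, .out, .res} ∪ Finset.univ.image .reg, fun k => by cases k <;> simp⟩

instance : Fintype CNFSym := ⟨⟨↑[CNFSym.tick, .pos, .neg, .sep], by simp⟩, fun s => by cases s <;> simp⟩

instance : Fintype CircuitSym :=
  ⟨⟨↑[CircuitSym.tick, .sep, .and, .or, .not], by simp⟩, fun s => by cases s <;> simp⟩

variable (A : Algorithm CircuitSym (Option Bool))

/-- The alphabets of the stacks. -/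
def Alph : Own ⊕ A.tm.K → Type
  | .inl .inp => CNFSym
  | .inl .out => CircuitSym
  | .inl .res => Bool
  | .inl (.reg _) => Unit
  | .inr k => A.tm.Γ k

/-- The internal states: the symbol that was read last, and the state of the simulated machine. -/
abbrev Var : Type := Option (CNFSym ⊕ CircuitSym ⊕ Option Bool) × A.tm.σ

/-- The contents of the stacks. -/
structure St : Type where
  inp : List CNFSym
  out : List CircuitSym
  res : List Bool
  reg : Reg → ℕ
  sim : ∀ k, List (A.tm.Γ k)

variable {A}

namespace St

/-- A counter is a stack over a one-letter alphabet whose height is its value. -/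
def stk (s : St A) : ∀ k, List (Alph A k)
  | .inl .inp => s.inp
  | .inl .out => s.out
  | .inl .res => s.res
  | .inl (.reg r) => List.replicate (s.reg r) ()
  | .inr k => s.sim k

/-- Change the value of a counter. -/
def set (s : St A) (r : Reg) (m : ℕ) : St A := { s with reg := Function.update s.reg r m }

@[simp] theorem set_inp (s : St A) (r : Reg) (m : ℕ) : (s.set r m).inp = s.inp := rfl
@[simp] theorem set_out (s : St A) (r : Reg) (m : ℕ) : (s.set r m).out = s.out := rfl
@[simp] theorem set_res (s : St A) (r : Reg) (m : ℕ) : (s.set r m).res = s.res := rfl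
@[simp] theorem set_sim (s : St A) (r : Reg) (m : ℕ) : (s.set r m).sim = s.sim := rfl
@[simp] theorem set_reg (s : St A) (r : Reg) (m : ℕ) :
    (s.set r m).reg = Function.update s.reg r m := rfl

theorem set_self (s : St A) (r : Reg) : s.set r (s.reg r) = s := by
  simp [set]

theorem set_eq_self {s : St A} {r : Reg} {m : ℕ} (h : s.reg r = m) : s.set r m = s := by
  rw [← h, set_self]

theorem update_eq_of {s s' : St A} {k : Own ⊕ A.tm.K} {l : List (Alph A k)} (h : s'.stk k = l)
    (h' : ∀ k' ≠ k, s'.stk k' = s.stk k') : Function.update s.stk k l = s'.stk := by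
  funext k'
  by_cases hk : k' = k
  · subst hk
    rw [Function.update_self, h]
  · rw [Function.update_of_ne hk, h' k' hk]

theorem update_inp (s : St A) (l : List CNFSym) :
    Function.update s.stk (.inl .inp) l = { s with inp := l }.stk :=
  update_eq_of (s' := { s with inp := l }) rfl fun k hk => by
    rcases k with (_ | _ | _ | r) | k
    · exact (hk rfl).elim
    all_goals rfl

theorem update_out (s : St A) (l : List CircuitSym) :
    Function.update s.stk (.inl .out) l = { s with out := l }.stk :=
  update_eq_of (s' := { s with out := l }) rfl fun k hk => by
    rcases k with (_ | _ | _ | r) | k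
    · rfl
    · exact (hk rfl).elim
    all_goals rfl

theorem update_res (s : St A) (l : List Bool) :
    Function.update s.stk (.inl .res) l = { s with res := l }.stk :=
  update_eq_of (s' := { s with res := l }) rfl fun k hk => by
    rcases k with (_ | _ | _ | r) | k
    · rfl
    · rfl
    · exact (hk rfl).elim
    all_goals rfl

theorem update_reg (s : St A) (r : Reg) (m : ℕ) :
    Function.update s.stk (.inl (.reg r)) (List.replicate m ()) = (s.set r m).stk :=
  update_eq_of (congrArg (List.replicate · ()) (by simp : (s.set r m).reg r = m)) fun k hk => by
    rcases k with (_ | _ | _ | r') | k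
    any_goals rfl
    have hr : r' ≠ r := by
      rintro rfl
      exact hk rfl
    exact congrArg (List.replicate · ()) (by simp [hr] : (s.set r m).reg r' = s.reg r')

theorem update_sim (s : St A) (k : A.tm.K) (l : List (A.tm.Γ k)) :
    Function.update s.stk (.inr k) l = { s with sim := Function.update s.sim k l }.stk :=
  update_eq_of (s' := { s with sim := Function.update s.sim k l })
    (by simp only [stk, Function.update_self]; rfl) fun k' hk => by
    rcases k' with (_ | _ | _ | r') | k'
    any_goals rfl
    have hk' : k' ≠ k := by
      rintro rfl
      exact hk rfl
    exact Function.update_of_ne hk' l s.sim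

end St

/-- The program `p` turns the contents `s` of the stacks into `s'` in at most `T` steps. -/
def Exec (p : Prog (Alph A) (Var A)) (s s' : St A) (T : ℕ) : Prop := p.Run s.stk s'.stk T

theorem Exec.mono {p : Prog (Alph A) (Var A)} {s s' : St A} {T T' : ℕ} (h : Exec p s s' T)
    (hT : T ≤ T') : Exec p s s' T' := Prog.Run.mono h hT

theorem Exec.seq {p q : Prog (Alph A) (Var A)} {s s' s'' : St A} {T T' : ℕ} (hp : Exec p s s' T)
    (hq : Exec q s' s'' T') : Exec (p.seq q) s s'' (T + T') := Prog.Run.seq hp hq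

theorem Exec.congr {p : Prog (Alph A) (Var A)} {s s' s'' : St A} {T : ℕ} (h : Exec p s s' T)
    (hs : s' = s'') : Exec p s s'' T := hs ▸ h

end State

/-! ### Elementary programs and loops over counters and words -/

section Primitives

variable {A : Algorithm CircuitSym (Option Bool)}

def incr (r : Reg) : Prog (Alph A) (Var A) := .prim (.push (.inl (.reg r)) (fun _ => ()) .halt)

def decr (r : Reg) : Prog (Alph A) (Var A) := .prim (.pop (.inl (.reg r)) (fun v _ => v) .halt)

def pushOut (x : CircuitSym) : Prog (Alph A) (Var A) := .prim (.push (.inl .out) (fun _ => x) .halt)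

def popOut : Prog (Alph A) (Var A) := .prim (.pop (.inl .out) (fun v _ => v) .halt)

def popInp : Prog (Alph A) (Var A) := .prim (.pop (.inl .inp) (fun v _ => v) .halt)

def pushRes (b : Bool) : Prog (Alph A) (Var A) := .prim (.push (.inl .res) (fun _ => b) .halt)

def popRes : Prog (Alph A) (Var A) := .prim (.pop (.inl .res) (fun v _ => v) .halt)

def pushExt (k : A.tm.K) (x : A.tm.Γ k) : Prog (Alph A) (Var A) :=
  .prim (.push (.inr k) (fun _ => x) .halt)

theorem exec_incr (r : Reg) (s : St A) : Exec (incr r) s (s.set r (s.reg r + 1)) 1 :=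
  Prog.Run.prim fun v => ⟨v, congrArg (TM2.Cfg.mk none v) (s.update_reg r (s.reg r + 1))⟩

theorem exec_decr (r : Reg) (s : St A) : Exec (decr r) s (s.set r (s.reg r - 1)) 1 :=
  Prog.Run.prim fun v => ⟨v, congrArg (TM2.Cfg.mk none v) (by
    rw [← St.update_reg]
    congr 1
    exact List.tail_replicate)⟩

theorem exec_pushOut (x : CircuitSym) (s : St A) :
    Exec (pushOut x) s { s with out := x :: s.out } 1 :=
  Prog.Run.prim fun v => ⟨v, congrArg (TM2.Cfg.mk none v) (s.update_out _)⟩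

theorem exec_popOut (s : St A) : Exec popOut s { s with out := s.out.tail } 1 :=
  Prog.Run.prim fun v => ⟨v, congrArg (TM2.Cfg.mk none v) (s.update_out _)⟩

theorem exec_popInp (s : St A) : Exec popInp s { s with inp := s.inp.tail } 1 :=
  Prog.Run.prim fun v => ⟨v, congrArg (TM2.Cfg.mk none v) (s.update_inp _)⟩

theorem exec_pushRes (b : Bool) (s : St A) : Exec (pushRes b) s { s with res := b :: s.res } 1 :=
  Prog.Run.prim fun v => ⟨v, congrArg (TM2.Cfg.mk none v) (s.update_res _)⟩

theorem exec_popRes (s : St A) : Exec popRes s { s with res := s.res.tail } 1 :=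
  Prog.Run.prim fun v => ⟨v, congrArg (TM2.Cfg.mk none v) (s.update_res _)⟩

theorem exec_pushExt (k : A.tm.K) (x : A.tm.Γ k) (s : St A) :
    Exec (pushExt k x) s { s with sim := Function.update s.sim k (x :: s.sim k) } 1 :=
  Prog.Run.prim fun v => ⟨v, congrArg (TM2.Cfg.mk none v) (s.update_sim k _)⟩

/-- Decrease the counter `r` as long as it is positive, and run `p` each time. -/
def whileReg (r : Reg) (p : Prog (Alph A) (Var A)) : Prog (Alph A) (Var A) :=
  .popLoop (.inl (.reg r)) (fun v a => (a.map fun _ => .inl .tick, v.2))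
    (fun v => v.1.map fun _ => ()) fun _ => p

theorem exec_whileReg_zero {r : Reg} {p : Prog (Alph A) (Var A)} {s : St A} (h : s.reg r = 0) :
    Exec (whileReg r p) s s 1 :=
  Prog.Run.popLoop_nil (congrArg (List.replicate · ()) h) fun _ => rfl

theorem exec_whileReg_succ {r : Reg} {p : Prog (Alph A) (Var A)} {s s' s'' : St A} {T T' : ℕ}
    (h : s.reg r ≠ 0) (hp : Exec p (s.set r (s.reg r - 1)) s' T)
    (hl : Exec (whileReg r p) s' s'' T') : Exec (whileReg r p) s s'' (T + T' + 1) := by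
  obtain ⟨m, hm⟩ := Nat.exists_eq_succ_of_ne_zero h
  refine Prog.Run.popLoop_cons (i := ()) (congrArg (List.replicate · ()) hm) (fun _ => rfl) ?_ hl
  rw [hm] at hp
  exact s.update_reg r m ▸ hp

/-- The states are indexed by the number of rounds still to come, so the loop runs from `f n` down
to `f 0`. -/
theorem exec_whileReg {r : Reg} {p : Prog (Alph A) (Var A)} (f : ℕ → St A) (T n : ℕ)
    (h0 : (f 0).reg r = 0) (hs : ∀ m < n, (f (m + 1)).reg r ≠ 0 ∧
      Exec p ((f (m + 1)).set r ((f (m + 1)).reg r - 1)) (f m) T) :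
    Exec (whileReg r p) (f n) (f 0) (n * (T + 1) + 1) := by
  induction n with
  | zero => exact (exec_whileReg_zero h0).mono (by omega)
  | succ n ih =>
    obtain ⟨h₁, h₂⟩ := hs n (Nat.lt_succ_self n)
    exact (exec_whileReg_succ h₁ h₂ (ih fun m hm => hs m (hm.trans (Nat.lt_succ_self n)))).mono
      (by ring_nf; omega)

/-- `popLoop` needs a default label for a jump that is taken only when a symbol was selected. -/
instance : Inhabited CNFSym := ⟨.tick⟩

instance : Inhabited CircuitSym := ⟨.tick⟩

/-- Read the input to its end, and run `p x` on each symbol `x`. -/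
def forInp (p : CNFSym → Prog (Alph A) (Var A)) : Prog (Alph A) (Var A) :=
  .popLoop (.inl .inp) (fun v a => (a.map .inl, v.2))
    (fun v => v.1.bind fun x => match x with | .inl x => some x | _ => none) p

theorem exec_forInp_nil {p : CNFSym → Prog (Alph A) (Var A)} {s : St A} (h : s.inp = []) :
    Exec (forInp p) s s 1 :=
  Prog.Run.popLoop_nil h fun _ => rfl

theorem exec_forInp_cons {p : CNFSym → Prog (Alph A) (Var A)} {s s' s'' : St A} {T T' : ℕ}
    {x : CNFSym} {l : List CNFSym} (h : s.inp = x :: l) (hp : Exec (p x) { s with inp := l } s' T)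
    (hl : Exec (forInp p) s' s'' T') : Exec (forInp p) s s'' (T + T' + 1) :=
  Prog.Run.popLoop_cons (i := x) h (fun _ => rfl) (s.update_inp l ▸ hp) hl

/-- Read the input as long as its next symbol is a tick, and run `p` each time. -/
def whileTick (p : Prog (Alph A) (Var A)) : Prog (Alph A) (Var A) :=
  .loop (ι := Unit) (.peek (.inl .inp) (fun v a => (a.map .inl, v.2))
    (.branch (fun v => match v.1 with | some (.inl .tick) => true | _ => false)
      (.pop (.inl .inp) (fun v _ => v) (.goto fun _ => ())) .halt)) fun _ => p

/-- The loop peeks before it pops, so the symbol that ends a unary number stays on the input for the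
next reader. -/
theorem exec_whileTick_exit {p : Prog (Alph A) (Var A)} {s : St A}
    (h : s.inp.head? ≠ some .tick) : Exec (whileTick p) s s 1 := by
  refine Prog.Run.loop_exit fun v => ⟨(s.inp.head?.map .inl, v.2), ?_⟩
  obtain ⟨l, out, res, reg, sim⟩ := s
  rcases l with _ | ⟨_ | _ | _ | _, l⟩
  any_goals rfl
  exact (h rfl).elim

theorem exec_whileTick_step {p : Prog (Alph A) (Var A)} {s s' s'' : St A} {T T' : ℕ}
    {l : List CNFSym} (h : s.inp = .tick :: l) (hp : Exec p { s with inp := l } s' T)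
    (hl : Exec (whileTick p) s' s'' T') : Exec (whileTick p) s s'' (T + T' + 1) := by
  refine Prog.Run.loop_step () (fun v => ⟨(some (.inl .tick), v.2), ?_⟩) hp hl
  obtain ⟨l, out, res, reg, sim⟩ := s
  cases h
  exact congrArg (TM2.Cfg.mk _ _) (St.update_inp _ _)

/-- Pop all symbols from the stack `out`, and run `p x` on each symbol `x`. -/
def forOut (p : CircuitSym → Prog (Alph A) (Var A)) : Prog (Alph A) (Var A) :=
  .popLoop (.inl .out) (fun v a => (a.map fun x => .inr (.inl x), v.2))
    (fun v => v.1.bind fun x => match x with | .inr (.inl x) => some x | _ => none) p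

theorem exec_forOut_nil {p : CircuitSym → Prog (Alph A) (Var A)} {s : St A} (h : s.out = []) :
    Exec (forOut p) s s 1 :=
  Prog.Run.popLoop_nil h fun _ => rfl

theorem exec_forOut_cons {p : CircuitSym → Prog (Alph A) (Var A)} {s s' s'' : St A} {T T' : ℕ}
    {x : CircuitSym} {l : List CircuitSym} (h : s.out = x :: l)
    (hp : Exec (p x) { s with out := l } s' T) (hl : Exec (forOut p) s' s'' T') :
    Exec (forOut p) s s'' (T + T' + 1) :=
  Prog.Run.popLoop_cons (i := x) h (fun _ => rfl) (s.update_out l ▸ hp) hl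

/-- Pop all symbols from the output stack of the simulated machine, and run `p x` on each
symbol `x`. -/
def forAnswer (p : Option Bool → Prog (Alph A) (Var A)) : Prog (Alph A) (Var A) :=
  .popLoop (.inr A.tm.k₁) (fun v a => (a.map fun x => .inr (.inr (A.outputAlphabet x)), v.2))
    (fun v => v.1.bind fun x => match x with | .inr (.inr x) => some x | _ => none) p

theorem exec_forAnswer_nil {p : Option Bool → Prog (Alph A) (Var A)} {s : St A}
    (h : s.sim A.tm.k₁ = []) : Exec (forAnswer p) s s 1 :=
  Prog.Run.popLoop_nil h fun _ => rfl

theorem exec_forAnswer_cons {p : Option Bool → Prog (Alph A) (Var A)} {s s' s'' : St A} {T T' : ℕ}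
    {x : Option Bool} {l : List (A.tm.Γ A.tm.k₁)}
    (h : s.sim A.tm.k₁ = A.outputAlphabet.symm x :: l)
    (hp : Exec (p x) { s with sim := Function.update s.sim A.tm.k₁ l } s' T)
    (hl : Exec (forAnswer p) s' s'' T') : Exec (forAnswer p) s s'' (T + T' + 1) :=
  Prog.Run.popLoop_cons (i := x) h
    (fun _ => congrArg some (A.outputAlphabet.apply_symm_apply x)) (s.update_sim A.tm.k₁ l ▸ hp) hl

end Primitives

end MaxListing

namespace MaxListing

open Turing

/-! ### How fast stacks grow -/

section StackGrowth

variable {K : Type} [DecidableEq K] {Γ : K → Type} {σ Λ : Type}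

/-- A bound on the number of symbols that a statement pushes. -/
def numPush : TM2.Stmt Γ Λ σ → ℕ
  | .push _ _ q => numPush q + 1
  | .peek _ _ q => numPush q
  | .pop _ _ q => numPush q
  | .load _ q => numPush q
  | .branch _ q₁ q₂ => numPush q₁ + numPush q₂
  | .goto _ => 0
  | .halt => 0

theorem length_stepAux_le (q : TM2.Stmt Γ Λ σ) (v : σ) (S : ∀ k, List (Γ k)) (k : K) :
    ((TM2.stepAux q v S).stk k).length ≤ (S k).length + numPush q := by
  induction q generalizing v S with
  | push k' f q ih =>
    refine (ih _ _).trans ?_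
    by_cases h : k = k'
    · subst h
      simp [numPush]
      omega
    · simp [numPush, h]
  | peek k' f q ih => exact ih _ _
  | pop k' f q ih =>
    refine (ih _ _).trans ?_
    by_cases h : k = k'
    · subst h
      simp [numPush]
    · simp [numPush, h]
  | load f q ih => exact ih _ _
  | branch f q₁ q₂ ih₁ ih₂ =>
    have h₁ := ih₁ v S
    have h₂ := ih₂ v S
    simp only [TM2.stepAux, numPush]
    cases f v
    · simp only [cond_false]; omega
    · simp only [cond_true]; omega
  | goto l => simp
  | halt => simp

/-- There are finitely many statements, each with boundedly many pushes. This bounds the length of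
the output of `A`, and hence the time for scanning it. -/
theorem exists_length_le [Fintype Λ] (m : Λ → TM2.Stmt Γ Λ σ) :
    ∃ c : ℕ, ∀ (t : ℕ) (a b : TM2.Cfg Γ Λ σ), StepsTo m t a b → ∀ k,
      (b.stk k).length ≤ (a.stk k).length + c * t := by
  refine ⟨Finset.univ.sup fun l => numPush (m l), fun t => ?_⟩
  induction t with
  | zero =>
    intro a b h k
    cases Option.some.inj h
    simp
  | succ t ih =>
    rintro ⟨_ | l, v, S⟩ b h k
    · exact absurd h.of_halted.1 (Nat.succ_ne_zero t)
    · refine (ih _ _ (StepsTo.succ_iff.1 h) k).trans ?_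
      have h₁ := length_stepAux_le (m l) v S k
      have h₂ : numPush (m l) ≤ Finset.univ.sup fun l => numPush (m l) :=
        Finset.le_sup (f := fun l => numPush (m l)) (Finset.mem_univ l)
      rw [Nat.mul_succ]
      simp only
      omega

theorem StepsTo.exists_of_lt {m : Λ → TM2.Stmt Γ Λ σ} {n t : ℕ} {c : TM2.Cfg Γ Λ σ} {v : σ}
    {S : ∀ k, List (Γ k)} (h : StepsTo m t c ⟨none, v, S⟩) (hn : n < t) :
    ∃ l v' S', StepsTo m n c ⟨some l, v', S'⟩ := by
  obtain ⟨k, rfl⟩ := Nat.exists_eq_add_of_lt hn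
  unfold StepsTo at *
  rw [show n + k + 1 = (k + 1) + n by omega, Function.iterate_add_apply] at h
  rcases ho : (fun o : Option (TM2.Cfg Γ Λ σ) => o.bind (TM2.step m))^[n] (some c) with
    _ | ⟨_ | l, v', S'⟩
  · rw [ho, iterate_bind_none] at h
    cases h
  · rw [ho] at h
    exact absurd (StepsTo.of_halted h).1 (Nat.succ_ne_zero k)
  · exact ⟨l, v', S', rfl⟩

end StackGrowth

/-! ### Running the listing algorithm against a clock -/

section Simulation

variable {A : Algorithm CircuitSym (Option Bool)}

/-- A statement of `A` as a statement of the simulating machine, which sets the counter `done`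
when `A` halts. -/
def liftStmt : TM2.Stmt A.tm.Γ A.tm.Λ A.tm.σ → TM2.Stmt (Alph A) (Option A.tm.Λ) (Var A)
  | .push k f q => .push (.inr k) (fun v => f v.2) (liftStmt q)
  | .peek k f q => .peek (.inr k) (fun v a => (v.1, f v.2 a)) (liftStmt q)
  | .pop k f q => .pop (.inr k) (fun v a => (v.1, f v.2 a)) (liftStmt q)
  | .load f q => .load (fun v => (v.1, f v.2)) (liftStmt q)
  | .branch f q₁ q₂ => .branch (fun v => f v.2) (liftStmt q₁) (liftStmt q₂)
  | .goto l => .goto fun v => some (l v.2)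
  | .halt => .push (.inl (.reg .done)) (fun _ => ()) .halt

/-- A lifted statement never reads the first component of the internal state, and it touches a
counter only when `A` halts. -/
theorem stepAux_liftStmt (q : TM2.Stmt A.tm.Γ A.tm.Λ A.tm.σ) (v : Var A) (s : St A) :
    ∃ v', v'.2 = (TM2.stepAux q v.2 s.sim).var ∧
      TM2.stepAux (liftStmt q) v s.stk = match (TM2.stepAux q v.2 s.sim).l with
        | some l => ⟨some (some l), v', { s with sim := (TM2.stepAux q v.2 s.sim).stk }.stk⟩
        | none => ⟨none, v', ({ s with sim := (TM2.stepAux q v.2 s.sim).stk }.set .done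
            (s.reg .done + 1)).stk⟩ := by
  induction q generalizing v s with
  | push k f q ih =>
    obtain ⟨v', h₁, h₂⟩ := ih v { s with sim := Function.update s.sim k (f v.2 :: s.sim k) }
    exact ⟨v', h₁, (congrArg (TM2.stepAux (liftStmt q) v) (s.update_sim k _)).trans h₂⟩
  | peek k f q ih => exact ih (v.1, f v.2 (s.sim k).head?) s
  | pop k f q ih =>
    obtain ⟨v', h₁, h₂⟩ := ih (v.1, f v.2 (s.sim k).head?)
      { s with sim := Function.update s.sim k (s.sim k).tail }
    exact ⟨v', h₁, (congrArg (TM2.stepAux (liftStmt q) _) (s.update_sim k _)).trans h₂⟩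
  | load f q ih => exact ih (v.1, f v.2) s
  | branch f q₁ q₂ ih₁ ih₂ =>
    simp only [TM2.stepAux, liftStmt]
    cases f v.2
    · exact ih₂ v s
    · exact ih₁ v s
  | goto l => exact ⟨v, rfl, rfl⟩
  | halt => exact ⟨v, rfl, congrArg (TM2.Cfg.mk none v) (s.update_reg .done (s.reg .done + 1))⟩

variable (A) in
/-- Run `A` until it halts or has made as many steps as the counter `clock` says. -/
def simulate : Prog (Alph A) (Var A) :=
  letI := A.tm.ΛFin
  { Λ := Option A.tm.Λ
    fin := inferInstance
    entry := none
    code := fun l => match l with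
      | none => .load (fun v => (v.1, A.tm.initialState)) (.goto fun _ => some A.tm.main)
      | some l => .pop (.inl (.reg .clock)) (fun v a => (a.map fun _ => .inl .tick, v.2))
          (.branch (fun v => v.1.isSome) (liftStmt (A.tm.m l)) .halt) }

theorem stepAux_simulate_zero (l : A.tm.Λ) (v : Var A) {s : St A} (hc : s.reg .clock = 0) :
    TM2.stepAux ((simulate A).code (some l)) v s.stk = ⟨none, (none, v.2), s.stk⟩ := by
  have h : s.stk (.inl (.reg .clock)) = [] := congrArg (List.replicate · ()) hc
  have h' : Function.update s.stk (.inl (.reg .clock)) (s.stk (.inl (.reg .clock))).tail = s.stk := by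
    rw [h, List.tail_nil, ← h]
    simp
  simp only [simulate, TM2.stepAux, h']
  simp [h]

theorem stepAux_simulate_succ (l : A.tm.Λ) (v : Var A) {s : St A} {n : ℕ}
    (hc : s.reg .clock = n + 1) :
    TM2.stepAux ((simulate A).code (some l)) v s.stk =
      TM2.stepAux (liftStmt (A.tm.m l)) (some (.inl .tick), v.2) (s.set .clock n).stk := by
  have h : s.stk (.inl (.reg .clock)) = () :: List.replicate n () :=
    congrArg (List.replicate · ()) hc
  rw [← St.update_reg]
  simp only [simulate, TM2.stepAux, h]
  rfl

/-- Each step of `A` costs one step and one unit of the clock; the halting step raises `done`. -/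
theorem simulate_halts {t : ℕ} {l : A.tm.Λ} {v : Var A} {s : St A} {x : A.tm.σ}
    {S : ∀ k, List (A.tm.Γ k)}
    (h : StepsTo A.tm.m t ⟨some l, v.2, s.sim⟩ ⟨none, x, S⟩) (hc : t ≤ s.reg .clock) :
    ∃ v', StepsTo (simulate A).code t ⟨some (some l), v, s.stk⟩
      ⟨none, v', (({ s with sim := S }.set .clock (s.reg .clock - t)).set .done
        (s.reg .done + 1)).stk⟩ := by
  induction t generalizing l v s with
  | zero => cases Option.some.inj h
  | succ t ih =>
    obtain ⟨n, hn⟩ : ∃ n, s.reg .clock = n + 1 := ⟨s.reg .clock - 1, by omega⟩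
    have hstep := stepAux_simulate_succ l v hn
    have h := StepsTo.succ_iff.1 h
    obtain ⟨v', h₁, h₂⟩ := stepAux_liftStmt (A.tm.m l) (some (.inl .tick), v.2) (s.set .clock n)
    rw [h₂] at hstep
    simp only [St.set_sim] at h₁ hstep
    set c := TM2.stepAux (A.tm.m l) v.2 s.sim with hcdef
    obtain ⟨_ | l', x', S'⟩ := c
    · obtain ⟨rfl, hc'⟩ := h.of_halted
      cases hc'
      refine ⟨v', StepsTo.succ_iff.2 ?_⟩
      rw [hstep]
      have : s.reg .clock - (0 + 1) = n := by omega
      rw [this]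
      exact StepsTo.refl _ _
    · have := ih (l := l') (v := v') (s := { (s.set .clock n) with sim := S' })
        (by rw [h₁]; exact h) (by simp; omega)
      obtain ⟨w, hw⟩ := this
      refine ⟨w, StepsTo.succ_iff.2 ?_⟩
      rw [hstep]
      have e : s.reg .clock - (t + 1) = n - t := by omega
      rw [e]
      simp only [St.set, Function.update_self, Function.update_idem,
        Function.update_of_ne (show Reg.done ≠ Reg.clock by decide)] at hw ⊢
      exact hw

/-- After the clock has been used up, one further step finds it empty and halts with `done`
unchanged; hence `n + 1`. -/
theorem simulate_expires {n : ℕ} {l l' : A.tm.Λ} {v : Var A} {s : St A} {x : A.tm.σ}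
    {S : ∀ k, List (A.tm.Γ k)}
    (h : StepsTo A.tm.m n ⟨some l, v.2, s.sim⟩ ⟨some l', x, S⟩) (hc : s.reg .clock = n) :
    ∃ v', StepsTo (simulate A).code (n + 1) ⟨some (some l), v, s.stk⟩
      ⟨none, v', ({ s with sim := S }.set .clock 0).stk⟩ := by
  induction n generalizing l v s with
  | zero =>
    obtain ⟨rfl, -, rfl⟩ : l = l' ∧ v.2 = x ∧ s.sim = S := by
      simpa using Option.some.inj h
    refine ⟨(none, v.2), StepsTo.succ_iff.2 ?_⟩
    rw [stepAux_simulate_zero l v hc]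
    change StepsTo _ 0 _ ⟨none, _, (s.set .clock 0).stk⟩
    rw [St.set_eq_self hc]
    exact StepsTo.refl _ _
  | succ n ih =>
    have hstep := stepAux_simulate_succ l v hc
    obtain ⟨v', h₁, h₂⟩ := stepAux_liftStmt (A.tm.m l) (some (.inl .tick), v.2) (s.set .clock n)
    rw [h₂] at hstep
    simp only [St.set_sim] at h₁ hstep
    have h := StepsTo.succ_iff.1 h
    set c := TM2.stepAux (A.tm.m l) v.2 s.sim with hcdef
    obtain ⟨_ | l', x', S'⟩ := c
    · cases h.of_halted.2
    · have := ih (l := l') (v := v') (s := { (s.set .clock n) with sim := S' })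
        (by rw [h₁]; exact h) (by simp)
      obtain ⟨w, hw⟩ := this
      refine ⟨w, StepsTo.succ_iff.2 ?_⟩
      rw [hstep]
      simp only [St.set, Function.update_idem] at hw ⊢
      exact hw

theorem exec_simulate_of_le {s : St A} {t : ℕ} {x : A.tm.σ} {S : ∀ k, List (A.tm.Γ k)}
    (h : StepsTo A.tm.m t ⟨some A.tm.main, A.tm.initialState, s.sim⟩ ⟨none, x, S⟩)
    (hc : t ≤ s.reg .clock) :
    Exec (simulate A) s (({ s with sim := S }.set .clock (s.reg .clock - t)).set .done
      (s.reg .done + 1)) (s.reg .clock + 2) := by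
  intro v
  obtain ⟨v', hv⟩ := simulate_halts (v := (v.1, A.tm.initialState)) h hc
  exact ⟨v', t + 1, by omega, hv⟩

theorem exec_simulate_of_lt {s : St A} {t : ℕ} {x : A.tm.σ} {S : ∀ k, List (A.tm.Γ k)}
    (h : StepsTo A.tm.m t ⟨some A.tm.main, A.tm.initialState, s.sim⟩ ⟨none, x, S⟩)
    (hc : s.reg .clock < t) :
    ∃ S, Exec (simulate A) s ({ s with sim := S }.set .clock 0) (s.reg .clock + 2) := by
  obtain ⟨l', x', S', h'⟩ := h.exists_of_lt hc
  refine ⟨S', fun v => ?_⟩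
  obtain ⟨v', hv⟩ := simulate_expires (v := (v.1, A.tm.initialState)) h' rfl
  exact ⟨v', s.reg .clock + 1 + 1, by omega, hv⟩

end Simulation

end MaxListing

namespace MaxListing

/-! ### The circuit of the set system -/

section Gadget

/-- A gate that reads wires at given distances from its own wire, or negates a given wire. -/
inductive Rel : Type
  | and (c d : ℕ)
  | or (c d : ℕ)
  | not (c : ℕ)
  | lit (i : ℕ)

/-- The gate at wire `w`. -/
def Rel.at (w : ℕ) : Rel → Gate
  | .and c d => .and (w - c) (w - d)
  | .or c d => .or (w - c) (w - d)
  | .not c => .not (w - c)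
  | .lit i => .not i

/-- The gates from wire `w` on. -/
def place : ℕ → List Rel → List Gate
  | _, [] => []
  | w, r :: rs => r.at w :: place (w + 1) rs

theorem place_append (w : ℕ) (rs rs' : List Rel) :
    place w (rs ++ rs') = place w rs ++ place (w + rs.length) rs' := by
  induction rs generalizing w with
  | nil => rfl
  | cons r rs ih => simp [place, ih, Nat.add_assoc, Nat.add_comm 1]

theorem length_place (w : ℕ) (rs : List Rel) : (place w rs).length = rs.length := by
  induction rs generalizing w with
  | nil => rfl
  | cons r rs ih => simp [place, ih]

/-- The instructions of a machine with registers `Y`, `Z` and `C`, which the last three wires of a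
circuit carry: `C := C ∨ (x i = b)`, then `Z := Z ∧ C; C := 0`, and `Y := ¬ Z`. -/
inductive Tok : Type
  | lit (b : Bool) (i : ℕ)
  | fin
  | mark

def Tok.rels : Tok → List Rel
  | .lit b i => [.lit i, .not 1, .or 5 5, .or 5 5, .or 5 (bif b then 3 else 4)]
  | .fin => [.or 3 3, .and 3 2, .and 0 0]
  | .mark => [.not 2, .or 3 3, .and 0 0]

def Tok.sem (x : ℕ → Bool) : Tok → Bool × Bool × Bool → Bool × Bool × Bool
  | .lit b i, (Y, Z, C) => (Y, Z, C || x i == b)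
  | .fin, (Y, Z, C) => (Y, Z && C, false)
  | .mark, (_, Z, _) => (!Z, Z, false)

theorem Tok.sem_lit (x : ℕ → Bool) (b : Bool) (i : ℕ) (Y Z C : Bool) :
    (Tok.lit b i).sem x (Y, Z, C) = (Y, Z, C || x i == b) := rfl

theorem Tok.sem_fin (x : ℕ → Bool) (Y Z C : Bool) :
    Tok.fin.sem x (Y, Z, C) = (Y, Z && C, false) := rfl

theorem Tok.sem_mark (x : ℕ → Bool) (Y Z C : Bool) :
    Tok.mark.sem x (Y, Z, C) = (!Z, Z, false) := rfl

/-- The literals of an instruction refer to wires below `N`. -/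
def Tok.Below (N : ℕ) : Tok → Prop
  | .lit _ i => i < N
  | _ => True

/-- Append the values of gates to the list of the values of the wires. -/
def wires (ws : List Bool) (rs : List Rel) : List Bool :=
  rs.foldl (fun ws r => ws ++ [(r.at ws.length).eval ws]) ws

theorem foldl_place (ws : List Bool) (rs : List Rel) :
    (place ws.length rs).foldl (fun w g => w ++ [g.eval w]) ws = wires ws rs := by
  induction rs generalizing ws with
  | nil => rfl
  | cons r rs ih =>
    have := ih (ws ++ [(r.at ws.length).eval ws])
    rw [List.length_append, List.length_singleton] at this
    exact this

theorem wires_append (ws : List Bool) (rs rs' : List Rel) :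
    wires ws (rs ++ rs') = wires (wires ws rs) rs' := List.foldl_append

/-- The case `c = 0` is a gate that reads its own wire, which does not exist yet and counts as
`false`. The constants are made in this way. -/
theorem getD_back (pre suf : List Bool) {c : ℕ} (hc : c ≤ suf.length) :
    (pre ++ suf).getD ((pre ++ suf).length - c) false = suf.getD (suf.length - c) false := by
  rw [List.getD_append_right _ _ _ _ (by simp; omega)]
  congr 1
  simp
  omega

/-- The last three wires carry the given values, and the first `N` wires the values of `x`. -/
def Carries (x : ℕ → Bool) (N : ℕ) (ws : List Bool) (s : Bool × Bool × Bool) : Prop :=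
  ∃ pre : List Bool, ws = pre ++ [s.1, s.2.1, s.2.2] ∧ N ≤ pre.length ∧
    ∀ i < N, pre.getD i false = x i

/-- The gates of every instruction end with fresh wires for Y, Z and C in this order; the old ones
join the prefix, whose first `N` wires stay the inputs. -/
theorem Carries.step {x : ℕ → Bool} {N : ℕ} {ws : List Bool} {s : Bool × Bool × Bool}
    (h : Carries x N ws s) {t : Tok} (ht : t.Below N) :
    Carries x N (wires ws t.rels) (t.sem x s) := by
  obtain ⟨pre, rfl, hN, hx⟩ := h
  obtain ⟨Y, Z, C⟩ := s
  have hx' : ∀ (suf : List Bool), ∀ i < N, (pre ++ suf).getD i false = x i := fun suf i hi => by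
    rw [List.getD_append _ _ _ _ (hi.trans_le hN), hx i hi]
  cases t with
  | lit b i =>
    refine ⟨pre ++ [Y, Z, C, !x i, x i], ?_, by simp; omega, hx' _⟩
    simp only [wires, Tok.rels, List.foldl_cons, List.foldl_nil, Rel.at, Gate.eval, hx' _ i ht,
      List.append_assoc, List.cons_append, List.nil_append]
    have h4 : (bif b then 3 else 4) ≤ 7 := by cases b <;> decide
    simp only [getD_back, List.length_cons, List.length_nil, h4, Nat.reduceAdd, Nat.reduceLeDiff,
      List.append_cancel_left_eq, Tok.sem]
    cases b <;> cases C <;> cases x i <;> simp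
  | fin =>
    refine ⟨pre ++ [Y, Z, C], ?_, by simp; omega, hx' _⟩
    simp only [wires, Tok.rels, List.foldl_cons, List.foldl_nil, Rel.at, Gate.eval,
      List.append_assoc, List.cons_append, List.nil_append]
    simp only [getD_back, List.length_cons, List.length_nil, Nat.reduceAdd, Nat.reduceLeDiff,
      List.append_cancel_left_eq, Tok.sem]
    simp
  | mark =>
    refine ⟨pre ++ [Y, Z, C], ?_, by simp; omega, hx' _⟩
    simp only [wires, Tok.rels, List.foldl_cons, List.foldl_nil, Rel.at, Gate.eval,
      List.append_assoc, List.cons_append, List.nil_append]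
    simp only [getD_back, List.length_cons, List.length_nil, Nat.reduceAdd, Nat.reduceLeDiff,
      List.append_cancel_left_eq, Tok.sem]
    simp

theorem Carries.steps {x : ℕ → Bool} {N : ℕ} {ws : List Bool} {s : Bool × Bool × Bool}
    (h : Carries x N ws s) {ts : List Tok} (ht : ∀ t ∈ ts, t.Below N) :
    Carries x N (wires ws (ts.flatMap Tok.rels)) (ts.foldl (fun s t => t.sem x s) s) := by
  induction ts generalizing ws s with
  | nil => exact h
  | cons t ts ih =>
    rw [List.flatMap_cons, wires_append]
    exact ih (h.step (ht t List.mem_cons_self)) fun t' h' => ht t' (List.mem_cons_of_mem _ h')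

/-- The instructions that evaluate a list of clauses. -/
def clauseToks (cls : List (List (Bool × ℕ))) : List Tok :=
  cls.flatMap fun c => c.map (fun l => .lit l.1 l.2) ++ [.fin]

/-- The truth value of a list of clauses. -/
def holds (x : ℕ → Bool) (cls : List (List (Bool × ℕ))) : Bool :=
  cls.all fun c => c.any fun l => x l.2 == l.1

theorem foldl_clauseToks (x : ℕ → Bool) (cls : List (List (Bool × ℕ))) (Y Z : Bool) :
    (clauseToks cls).foldl (fun s t => t.sem x s) (Y, Z, false) =
      (Y, Z && holds x cls, false) := by
  have hc : ∀ (c : List (Bool × ℕ)) (Z C : Bool),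
      (c.map fun l => Tok.lit l.1 l.2).foldl (fun s t => t.sem x s) (Y, Z, C) =
        (Y, Z, C || c.any fun l => x l.2 == l.1) := by
    intro c
    induction c with
    | nil => intro Z C; simp
    | cons l c ih => intro Z C; simp [Tok.sem_lit, ih, Bool.or_assoc]
  induction cls generalizing Z with
  | nil => simp [clauseToks, holds]
  | cons c cls ih =>
    have h : clauseToks (c :: cls) =
        c.map (fun l => Tok.lit l.1 l.2) ++ [.fin] ++ clauseToks cls := by
      simp [clauseToks]
    rw [h, List.foldl_append, List.foldl_append, hc]
    simp only [List.foldl_cons, List.foldl_nil, Tok.sem_fin]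
    rw [ih]
    simp [holds, Bool.and_assoc]

/-- The sets of weight at least 3, for the weights 1, 1, 1, 1, 2, are those that meet all of the
following sets. -/
def template : List (List ℕ) :=
  [[4, 0, 1], [4, 0, 2], [4, 0, 3], [4, 1, 2], [4, 1, 3], [4, 2, 3], [0, 1, 2, 3]]

/-- The `j`-th block consists of the elements `r * m + j` with `r < 5`. -/
def blockClauses (b : Bool) (m j : ℕ) : List (List (Bool × ℕ)) :=
  template.map fun c => c.map fun r => (b, r * m + j)

def blocks (b : Bool) (m : ℕ) : ℕ → List (List (Bool × ℕ))
  | 0 => []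
  | j + 1 => blockClauses b m j ++ blocks b m j

/-- The instructions for the set system of the clauses `cls`, with `m` blocks. -/
def gadgetToks (m : ℕ) (cls : List (List (Bool × ℕ))) : List Tok :=
  clauseToks (blocks true m m) ++ .mark ::
    clauseToks (blocks false m m ++ [[(false, 5 * m)]] ++ cls)

/-- The first three gates initialise Y, Z, C to false, true, false, and the last one outputs Y ∨ Z.
-/
def gadgetRels (m : ℕ) (cls : List (List (Bool × ℕ))) : List Rel :=
  [.and 0 0, .not 1, .and 0 0] ++ (gadgetToks m cls).flatMap Tok.rels ++ [.or 3 2]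

def gadget (m : ℕ) (cls : List (List (Bool × ℕ))) : Circuit (5 * m + 1) :=
  ⟨place (5 * m + 1) (gadgetRels m cls)⟩

theorem mem_blocks {b : Bool} {m k : ℕ} {c : List (Bool × ℕ)} :
    c ∈ blocks b m k ↔ ∃ j < k, c ∈ blockClauses b m j := by
  induction k with
  | zero => simp [blocks]
  | succ k ih =>
    rw [blocks, List.mem_append, ih]
    constructor
    · rintro (h | ⟨j, hj, h⟩)
      · exact ⟨k, k.lt_succ_self, h⟩
      · exact ⟨j, by omega, h⟩
    · rintro ⟨j, hj, h⟩
      rcases Nat.lt_succ_iff_lt_or_eq.1 hj with hj | rfl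
      · exact .inr ⟨j, hj, h⟩
      · exact .inl h

theorem lt_of_mem_blocks {b : Bool} {m : ℕ} {c : List (Bool × ℕ)} (hc : c ∈ blocks b m m)
    {l : Bool × ℕ} (hl : l ∈ c) : l.2 < 5 * m + 1 := by
  obtain ⟨j, hj, h⟩ := mem_blocks.1 hc
  obtain ⟨c', hc', rfl⟩ := List.mem_map.1 h
  obtain ⟨r, hr, rfl⟩ := List.mem_map.1 hl
  have : ∀ c ∈ template, ∀ r ∈ c, r ≤ 4 := by decide
  have := Nat.mul_le_mul_right m (this c' hc' r hr)
  simp only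
  omega

theorem below_clauseToks {N : ℕ} {cls : List (List (Bool × ℕ))}
    (h : ∀ c ∈ cls, ∀ l ∈ c, l.2 < N) : ∀ t ∈ clauseToks cls, t.Below N := by
  intro t ht
  obtain ⟨c, hc, ht⟩ := List.mem_flatMap.1 ht
  rcases List.mem_append.1 ht with ht | ht
  · obtain ⟨l, hl, rfl⟩ := List.mem_map.1 ht
    exact h c hc l hl
  · rw [List.mem_singleton.1 ht]
    trivial

theorem below_gadgetToks {m : ℕ} {cls : List (List (Bool × ℕ))}
    (h : ∀ c ∈ cls, ∀ l ∈ c, l.2 < 5 * m + 1) : ∀ t ∈ gadgetToks m cls, t.Below (5 * m + 1) := by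
  intro t ht
  rcases List.mem_append.1 ht with ht | ht
  · exact below_clauseToks (fun c hc l hl => lt_of_mem_blocks hc hl) t ht
  · rcases List.mem_cons.1 ht with rfl | ht
    · trivial
    · refine below_clauseToks (fun c hc l hl => ?_) t ht
      rcases List.mem_append.1 hc with hc | hc
      · rcases List.mem_append.1 hc with hc | hc
        · exact lt_of_mem_blocks hc hl
        · rw [List.mem_singleton.1 hc] at hl
          rw [List.mem_singleton.1 hl]
          simp
      · exact h c hc l hl

theorem eval_gadget {m : ℕ} {cls : List (List (Bool × ℕ))}
    (h : ∀ c ∈ cls, ∀ l ∈ c, l.2 < 5 * m + 1) (x : ℕ → Bool) :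
    (gadget m cls).eval (fun i => x i) =
      (!holds x (blocks true m m) ||
        (holds x (blocks false m m) && !x (5 * m) && holds x cls)) := by
  have h0 : Carries x (5 * m + 1)
      (wires (List.ofFn fun i : Fin (5 * m + 1) => x i) [.and 0 0, .not 1, .and 0 0])
      (false, true, false) := by
    refine ⟨List.ofFn fun i : Fin (5 * m + 1) => x i, ?_, by simp, fun i hi => ?_⟩
    · simp [wires, Rel.at, Gate.eval]
    · rw [List.getD_eq_getElem _ _ (by simpa using hi), List.getElem_ofFn]
  have h1 := h0.steps (below_gadgetToks h)
  have h2 : (gadgetToks m cls).foldl (fun s t => t.sem x s) (false, true, false) =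
      (!holds x (blocks true m m), holds x (blocks true m m) &&
        (holds x (blocks false m m) && !x (5 * m) && holds x cls), false) := by
    rw [gadgetToks, List.foldl_append, foldl_clauseToks, List.foldl_cons, Bool.true_and]
    rw [Tok.sem_mark, foldl_clauseToks]
    simp [holds, List.all_append, Bool.and_assoc]
  rw [h2] at h1
  obtain ⟨pre, hpre, -, -⟩ := h1
  have h3 := foldl_place (List.ofFn fun i : Fin (5 * m + 1) => x i) (gadgetRels m cls)
  rw [List.length_ofFn] at h3
  rw [Circuit.eval, gadget, h3, gadgetRels, wires_append, wires_append, hpre]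
  simp only [wires, List.foldl_cons, List.foldl_nil, Rel.at, Gate.eval]
  rw [getD_back _ _ (by simp), getD_back _ _ (by simp)]
  -- Z is not reset at the mark, so it still requires that no block is light. This is harmless,
  -- since Y is true when some block is.
  cases holds x (blocks true m m) <;> simp

end Gadget

end MaxListing

namespace MaxListing

/-! ### The set system: heredity, maximal solutions, and largest size -/

section Family

/-- The weight of the `j`-th block. -/
def weight (x : ℕ → Bool) (m j : ℕ) : ℕ :=
  (x (0 * m + j)).toNat + (x (1 * m + j)).toNat + (x (2 * m + j)).toNat + (x (3 * m + j)).toNat +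
    2 * (x (4 * m + j)).toNat

theorem holds_blockClauses_true (x : ℕ → Bool) (m j : ℕ) :
    holds x (blockClauses true m j) = decide (3 ≤ weight x m j) := by
  rw [Bool.eq_iff_iff, decide_eq_true_eq]
  simp only [holds, blockClauses, template, weight, List.map_cons, List.map_nil, List.all_cons,
    List.all_nil, List.any_cons, List.any_nil]
  generalize x (0 * m + j) = a
  generalize x (1 * m + j) = b
  generalize x (2 * m + j) = c
  generalize x (3 * m + j) = d
  generalize x (4 * m + j) = e
  revert a b c d e
  decide

/-- The total weight is 6, so a set has weight at most 3 exactly if its complement has weight at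
least 3. The same template, with negated literals, therefore works. -/
theorem holds_blockClauses_false (x : ℕ → Bool) (m j : ℕ) :
    holds x (blockClauses false m j) = decide (weight x m j ≤ 3) := by
  rw [Bool.eq_iff_iff, decide_eq_true_eq]
  simp only [holds, blockClauses, template, weight, List.map_cons, List.map_nil, List.all_cons,
    List.all_nil, List.any_cons, List.any_nil]
  generalize x (0 * m + j) = a
  generalize x (1 * m + j) = b
  generalize x (2 * m + j) = c
  generalize x (3 * m + j) = d
  generalize x (4 * m + j) = e
  revert a b c d e
  decide

theorem holds_eq_true {x : ℕ → Bool} {cls : List (List (Bool × ℕ))} :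
    holds x cls = true ↔ ∀ c ∈ cls, ∃ l ∈ c, x l.2 = l.1 := by
  simp [holds]

theorem holds_blocks {x : ℕ → Bool} {b : Bool} {m k : ℕ} :
    holds x (blocks b m k) = true ↔ ∀ j < k, holds x (blockClauses b m j) = true := by
  simp only [holds_eq_true, mem_blocks]
  constructor
  · exact fun h j hj c hc => h c ⟨j, hj, hc⟩
  · rintro h c ⟨j, hj, hc⟩
    exact h j hj c hc

/-- The characteristic function of a set of numbers below `N`. -/
def chi {N : ℕ} (X : Finset (Fin N)) (i : ℕ) : Bool := decide (∃ h : i < N, ⟨i, h⟩ ∈ X)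

theorem chi_coe {N : ℕ} (X : Finset (Fin N)) (i : Fin N) : chi X i = decide (i ∈ X) := by
  simp [chi]

theorem chi_eq_true {N : ℕ} {X : Finset (Fin N)} {i : Fin N} : chi X i = true ↔ i ∈ X := by
  simp [chi]

theorem chi_filter {N : ℕ} (x : ℕ → Bool) (h : ∀ i, N ≤ i → x i = false) :
    chi (Finset.univ.filter fun i : Fin N => x i = true) = x := by
  funext i
  by_cases hi : i < N
  · simp [chi, hi]
  · simp [chi, hi, h i (not_lt.1 hi)]

theorem chi_mono {N : ℕ} {X Y : Finset (Fin N)} (h : X ⊆ Y) (i : ℕ) : chi X i ≤ chi Y i := by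
  intro hi
  obtain ⟨h', hX⟩ := of_decide_eq_true hi
  exact decide_eq_true ⟨h', h hX⟩

theorem weight_congr {x y : ℕ → Bool} {m j : ℕ} (h : ∀ r < 5, x (r * m + j) = y (r * m + j)) :
    weight x m j = weight y m j := by
  simp only [weight, h 0 (by decide), h 1 (by decide), h 2 (by decide), h 3 (by decide),
    h 4 (by decide)]

theorem weight_mono {x y : ℕ → Bool} (h : ∀ i, x i ≤ y i) (m j : ℕ) :
    weight x m j ≤ weight y m j := by
  have h' := fun i => Bool.toNat_le_toNat (h i)
  have h0 := h' (0 * m + j)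
  have h1 := h' (1 * m + j)
  have h2 := h' (2 * m + j)
  have h3 := h' (3 * m + j)
  have h4 := h' (4 * m + j)
  unfold weight
  omega

/-- All five weights are positive, so enlarging a block strictly increases its weight. -/
theorem eq_of_weight_le {x y : ℕ → Bool} (h : ∀ i, x i ≤ y i) {m j : ℕ}
    (hw : weight y m j ≤ weight x m j) {r : ℕ} (hr : r < 5) : x (r * m + j) = y (r * m + j) := by
  have h' := fun i => Bool.toNat_le_toNat (h i)
  have h0 := h' (0 * m + j)
  have h1 := h' (1 * m + j)
  have h2 := h' (2 * m + j)
  have h3 := h' (3 * m + j)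
  have h4 := h' (4 * m + j)
  unfold weight at hw
  have hinj : ∀ a b : Bool, a.toNat = b.toNat → a = b := by decide
  interval_cases r <;> exact hinj _ _ (by omega)

theorem exists_block {m i : ℕ} (hi : i < 5 * m) : ∃ r < 5, ∃ j < m, i = r * m + j :=
  have hm : 0 < m := by omega
  ⟨i / m, Nat.div_lt_of_lt_mul (by rwa [Nat.mul_comm]), i % m, Nat.mod_lt i hm, by
    rw [Nat.mul_comm]; exact (Nat.div_add_mod i m).symm⟩

theorem block_lt {m r j : ℕ} (hr : r < 5) (hj : j < m) : r * m + j < 5 * m := by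
  have := Nat.mul_le_mul_right m (Nat.le_of_lt_succ hr)
  omega

variable {m : ℕ} {cls : List (List (Bool × ℕ))}

theorem mem_family (hcls : ∀ c ∈ cls, ∀ l ∈ c, l.2 < 5 * m) {X : Finset (Fin (5 * m + 1))} :
    X ∈ (gadget m cls).family ↔ (∃ j < m, weight (chi X) m j < 3) ∨
      ((∀ j < m, weight (chi X) m j ≤ 3) ∧ chi X (5 * m) = false ∧ holds (chi X) cls = true) := by
  have h := eval_gadget (fun c hc l hl => (hcls c hc l hl).trans (Nat.lt_succ_self _)) (chi X)
  simp only [chi_coe] at h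
  rw [Circuit.family, Set.mem_ofPred_eq, h, Bool.or_eq_true, Bool.and_eq_true, Bool.and_eq_true,
    Bool.not_eq_true', Bool.not_eq_true', Bool.eq_false_iff, Ne, holds_blocks, holds_blocks]
  simp only [holds_blockClauses_true, holds_blockClauses_false, decide_eq_true_eq, not_forall,
    not_le, exists_prop, and_assoc]

theorem isIndependence_gadget (hm : 0 < m) (hcls : ∀ c ∈ cls, ∀ l ∈ c, l.2 < 5 * m) :
    IsIndependence (gadget m cls).family := by
  refine ⟨(mem_family hcls).2 (.inl ⟨0, hm, ?_⟩), fun X Y hXY hY => ?_⟩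
  · simp [weight, chi]
  · have hmono := chi_mono hXY
    rw [mem_family hcls] at hY ⊢
    by_cases h : ∃ j < m, weight (chi X) m j < 3
    · exact .inl h
    · push Not at h
      rcases hY with ⟨j, hj, hY⟩ | ⟨h₁, h₂, h₃⟩
      · exact absurd (weight_mono hmono m j) (by have := h j hj; omega)
      -- Without a light block in `X`, the weights of `X` are at least 3 and those of `Y` at most 3,
      -- so the two sets agree on every block and in particular on the variables.
      · have heq : ∀ i < 5 * m, chi X i = chi Y i := fun i hi => by
          obtain ⟨r, hr, j, hj, rfl⟩ := exists_block hi
          exact eq_of_weight_le hmono ((h₁ j hj).trans (h j hj)) hr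
        refine .inr ⟨fun j hj => (weight_mono hmono m j).trans (h₁ j hj), ?_, ?_⟩
        · exact Bool.eq_false_of_le_false ((hmono _).trans h₂.le)
        · rw [holds_eq_true] at h₃ ⊢
          intro c hc
          obtain ⟨l, hl, h⟩ := h₃ c hc
          exact ⟨l, hl, (heq _ (hcls c hc l hl)).trans h⟩

/-- A solution of the clauses, with the two remaining elements of each block filled in such that
the weight is 3. -/
def completion (m : ℕ) (v : ℕ → Bool) (i : ℕ) : Bool :=
  let zeros := fun j => 3 - ((v (0 * m + j)).toNat + (v (1 * m + j)).toNat +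
    (v (2 * m + j)).toNat)
  if i < 3 * m then v i
  else if i < 4 * m then decide (zeros (i - 3 * m) % 2 = 1)
  else if i < 5 * m then decide (2 ≤ zeros (i - 4 * m))
  else false

/-- The weight that the three variables lack is between 0 and 3; rows 3 and 4, of weights 1 and 2,
hold its two binary digits. -/
theorem weight_completion (v : ℕ → Bool) {m j : ℕ} (hj : j < m) :
    weight (completion m v) m j = 3 := by
  have h0 : completion m v (0 * m + j) = v (0 * m + j) := if_pos (by omega)
  have h1 : completion m v (1 * m + j) = v (1 * m + j) := if_pos (by omega)
  have h2 : completion m v (2 * m + j) = v (2 * m + j) := if_pos (by omega)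
  have h3 : completion m v (3 * m + j) = decide ((3 - ((v (0 * m + j)).toNat +
      (v (1 * m + j)).toNat + (v (2 * m + j)).toNat)) % 2 = 1) := by
    unfold completion
    rw [if_neg (by omega), if_pos (by omega), Nat.add_sub_cancel_left]
  have h4 : completion m v (4 * m + j) = decide (2 ≤ 3 - ((v (0 * m + j)).toNat +
      (v (1 * m + j)).toNat + (v (2 * m + j)).toNat)) := by
    unfold completion
    rw [if_neg (by omega), if_neg (by omega), if_pos (by omega), Nat.add_sub_cancel_left]
  rw [weight, h0, h1, h2, h3, h4]
  generalize v (0 * m + j) = a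
  generalize v (1 * m + j) = b
  generalize v (2 * m + j) = c
  revert a b c
  decide

theorem exists_maximal_of_holds (hcls : ∀ c ∈ cls, ∀ l ∈ c, l.2 < 3 * m) {v : ℕ → Bool}
    (hv : holds v cls = true) :
    ∃ X ∈ maximalSolutions (gadget m cls).family, chi X (5 * m) = false := by
  have hcls' : ∀ c ∈ cls, ∀ l ∈ c, l.2 < 5 * m := fun c hc l hl =>
    (hcls c hc l hl).trans_le (by omega)
  set X : Finset (Fin (5 * m + 1)) := Finset.univ.filter fun i => completion m v i = true with hX
  have hchi : chi X = completion m v := chi_filter _ fun i hi => by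
    unfold completion
    rw [if_neg (by omega), if_neg (by omega), if_neg (by omega)]
  have hlast : chi X (5 * m) = false := by
    rw [hchi]
    unfold completion
    rw [if_neg (by omega), if_neg (by omega), if_neg (by omega)]
  have hw : ∀ j < m, weight (chi X) m j = 3 := fun j hj => by rw [hchi, weight_completion v hj]
  refine ⟨X, ⟨(mem_family hcls').2 (.inr ⟨fun j hj => (hw j hj).le, hlast, ?_⟩), ?_⟩, hlast⟩
  · rw [holds_eq_true] at hv ⊢
    intro c hc
    obtain ⟨l, hl, h⟩ := hv c hc
    refine ⟨l, hl, ?_⟩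
    rw [hchi, ← h]
    exact if_pos (hcls c hc l hl)
  -- A larger solution has no light block, so it is of the second kind: it agrees with `X` on the
  -- blocks and omits the last element.
  · intro Y hY hXY i hi
    have hmono := chi_mono hXY
    rcases (mem_family hcls').1 hY with ⟨j, hj, h⟩ | ⟨h₁, h₂, -⟩
    · exact absurd (weight_mono hmono m j) (by rw [hw j hj]; omega)
    · rcases Nat.lt_succ_iff_lt_or_eq.1 i.2 with h | h
      · rw [← chi_eq_true] at hi ⊢
        obtain ⟨r, hr, j, hj, h⟩ := exists_block h
        rw [h] at hi ⊢
        rw [eq_of_weight_le hmono (by rw [hw j hj]; exact h₁ j hj) hr, hi]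
      · rw [← chi_eq_true, h, h₂] at hi
        cases hi

/-- A light block stays light when elements outside it are added, so a maximal solution with a light
block contains everything outside that block. -/
theorem insert_mem_family (hcls : ∀ c ∈ cls, ∀ l ∈ c, l.2 < 5 * m) {X : Finset (Fin (5 * m + 1))}
    {j : ℕ} (hj : j < m) (hX : weight (chi X) m j < 3) {i : Fin (5 * m + 1)}
    (hi : ∀ r < 5, (i : ℕ) ≠ r * m + j) : insert i X ∈ (gadget m cls).family := by
  refine (mem_family hcls).2 (.inl ⟨j, hj, ?_⟩)
  rwa [weight_congr (y := chi X)]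
  intro r hr
  have hne := hi r hr
  unfold chi
  congr 1
  simp only [Finset.mem_insert, Fin.ext_iff, hne.symm, false_or]

/-- With a light block, the last element could still be added. -/
theorem holds_of_maximal (hcls : ∀ c ∈ cls, ∀ l ∈ c, l.2 < 5 * m) {X : Finset (Fin (5 * m + 1))}
    (hX : X ∈ maximalSolutions (gadget m cls).family) (hlast : chi X (5 * m) = false) :
    holds (chi X) cls = true := by
  rcases (mem_family hcls).1 hX.1 with ⟨j, hj, h⟩ | ⟨-, -, h⟩
  · have hmem := hX.2 (insert_mem_family hcls hj h (i := Fin.last (5 * m)) fun r hr => by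
      have := block_lt hr hj
      simp only [Fin.val_last]
      omega) (Finset.subset_insert _ _) (Finset.mem_insert_self _ _)
    rw [← chi_eq_true, Fin.val_last, hlast] at hmem
    cases hmem
  · exact h

/-- Only maximal solutions with a light block remain. Such a set is determined by the block and its
trace there, one of 2^5 subsets. -/
theorem numMaximal_gadget_le (hcls : ∀ c ∈ cls, ∀ l ∈ c, l.2 < 5 * m)
    (hunsat : ∀ v, holds v cls = false) : numMaximal (gadget m cls).family ≤ 32 * m := by
  classical
  let g : Fin m × (Fin 5 → Bool) → Finset (Fin (5 * m + 1)) := fun p =>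
    Finset.univ.filter fun i => ∀ r : Fin 5, (i : ℕ) = r * m + p.1 → p.2 r = true
  have hsub : maximalSolutions (gadget m cls).family ⊆ g '' Set.univ := by
    intro X hX
    rcases (mem_family hcls).1 hX.1 with ⟨j, hj, h⟩ | ⟨-, -, h⟩
    · refine ⟨(⟨j, hj⟩, fun r => chi X (r * m + j)), trivial, ?_⟩
      ext i
      simp only [g, Finset.mem_filter, Finset.mem_univ, true_and]
      constructor
      · intro hi
        by_cases hb : ∃ r : Fin 5, (i : ℕ) = r * m + j
        · obtain ⟨r, hr⟩ := hb
          have := hi r hr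
          rw [← hr] at this
          exact chi_eq_true.1 this
        · exact hX.2 (insert_mem_family hcls hj h (i := i) fun r hr hir => hb ⟨⟨r, hr⟩, hir⟩)
            (Finset.subset_insert _ _) (Finset.mem_insert_self _ _)
      · intro hi r hr
        rw [← hr]
        exact chi_eq_true.2 hi
    · rw [hunsat] at h
      cases h
  calc numMaximal (gadget m cls).family ≤ (g '' Set.univ).ncard :=
        Set.ncard_le_ncard hsub (Set.toFinite _)
    _ ≤ (Set.univ : Set (Fin m × (Fin 5 → Bool))).ncard := Set.ncard_image_le (Set.toFinite _)
    _ = 32 * m := by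
        rw [Set.ncard_univ, Nat.card_eq_fintype_card]
        simp [Nat.mul_comm]

theorem maxSize_gadget_le (hm : 0 < m) (hcls : ∀ c ∈ cls, ∀ l ∈ c, l.2 < 5 * m) :
    maxSize (gadget m cls).family ≤ 5 * m + 1 := by
  refine csSup_le ⟨_, ∅, (isIndependence_gadget hm hcls).1, rfl⟩ ?_
  rintro _ ⟨X, -, rfl⟩
  exact (Finset.card_le_univ X).trans_eq (Fintype.card_fin _)

/-- The set of all elements outside block 0 is a solution of size 5m − 4. -/
theorem le_maxSize_gadget (hm : 0 < m) (hcls : ∀ c ∈ cls, ∀ l ∈ c, l.2 < 5 * m) :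
    5 * m ≤ maxSize (gadget m cls).family + 4 := by
  classical
  let X : Finset (Fin (5 * m + 1)) :=
    Finset.univ.filter fun i => ∀ r : Fin 5, (i : ℕ) ≠ r * m + 0
  have hX : X ∈ (gadget m cls).family := by
    refine (mem_family hcls).2 (.inl ⟨0, hm, ?_⟩)
    have h : ∀ r < 5, chi X (r * m + 0) = false := fun r hr => by
      refine decide_eq_false ?_
      rintro ⟨h, h'⟩
      exact (Finset.mem_filter.1 h').2 ⟨r, hr⟩ rfl
    simp only [weight, h 0 (by decide), h 1 (by decide), h 2 (by decide), h 3 (by decide),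
      h 4 (by decide)]
    decide
  have hcard : 5 * m + 1 ≤ X.card + 5 := by
    let Y : Finset (Fin (5 * m + 1)) := Finset.univ.image fun r : Fin 5 =>
      ⟨r * m + 0, (block_lt r.2 hm).trans (Nat.lt_succ_self _)⟩
    have hY : Y.card ≤ 5 := Finset.card_image_le.trans_eq (by simp)
    have hXY : Finset.univ ⊆ X ∪ Y := fun i _ => by
      by_cases h : ∃ r : Fin 5, (i : ℕ) = r * m + 0
      · obtain ⟨r, hr⟩ := h
        exact Finset.mem_union_right _ (Finset.mem_image.2 ⟨r, Finset.mem_univ _, Fin.ext hr.symm⟩)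
      · exact Finset.mem_union_left _ (Finset.mem_filter.2 ⟨Finset.mem_univ _, fun r hr => h ⟨r, hr⟩⟩)
    have := (Finset.card_le_card hXY).trans (Finset.card_union_le X Y)
    rw [Finset.card_univ, Fintype.card_fin] at this
    omega
  have : X.card ≤ maxSize (gadget m cls).family :=
    le_csSup ⟨5 * m + 1, by
      rintro _ ⟨X, -, rfl⟩
      exact (Finset.card_le_univ X).trans_eq (Fintype.card_fin _)⟩ ⟨X, hX, rfl⟩
  omega

end Family

end MaxListing

namespace MaxListing

open Turing

/-! ### Counter arithmetic: repetition, transfer and copying -/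

section Macros

variable {A : Algorithm CircuitSym (Option Bool)}

theorem St.ext' {s s' : St A} (h₁ : s.inp = s'.inp) (h₂ : s.out = s'.out) (h₃ : s.res = s'.res)
    (h₄ : ∀ r, s.reg r = s'.reg r) (h₅ : s.sim = s'.sim) : s = s' := by
  obtain ⟨i, o, e, r, m⟩ := s
  obtain ⟨i', o', e', r', m'⟩ := s'
  obtain rfl : r = r' := funext h₄
  subst h₁ h₂ h₃ h₅
  rfl

def skip : Prog (Alph A) (Var A) := .prim .halt

theorem exec_skip (s : St A) : Exec skip s s 1 := Prog.Run.prim fun v => ⟨v, rfl⟩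

/-- Run the programs of a list one after the other. -/
def seqList (ps : List (Prog (Alph A) (Var A))) : Prog (Alph A) (Var A) := ps.foldr Prog.seq skip

/-- Run a program `n` times. -/
def times (n : ℕ) (p : Prog (Alph A) (Var A)) : Prog (Alph A) (Var A) :=
  seqList (List.replicate n p)

theorem exec_times {p : Prog (Alph A) (Var A)} (f : ℕ → St A) (T n : ℕ)
    (h : ∀ i < n, Exec p (f i) (f (i + 1)) T) : Exec (times n p) (f 0) (f n) (n * T + 1) := by
  induction n generalizing f with
  | zero => exact (exec_skip _).mono (by omega)
  | succ n ih =>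
    exact ((h 0 (Nat.succ_pos n)).seq (ih (fun i => f (i + 1)) fun i hi =>
      h (i + 1) (Nat.succ_lt_succ hi))).mono (by ring_nf; omega)

theorem exec_times_incr (n : ℕ) (r : Reg) (s : St A) :
    Exec (times n (incr r)) s (s.set r (s.reg r + n)) (n + 1) := by
  have h := exec_times (p := incr r) (fun i => s.set r (s.reg r + i)) 1 n fun i _ =>
    (exec_incr r _).congr (by simp [St.set, Nat.add_assoc])
  simp only [Nat.add_zero, St.set_self, Nat.mul_one] at h
  exact h

theorem exec_times_popOut (n : ℕ) (s : St A) :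
    Exec (times n popOut) s { s with out := s.out.drop n } (n + 1) := by
  have h := exec_times (p := popOut) (fun i => { s with out := s.out.drop i }) 1 n fun i _ =>
    (exec_popOut _).congr (by simp)
  simp only [List.drop_zero, Nat.mul_one] at h
  exact h

theorem St.set_set (s : St A) (r : Reg) (m n : ℕ) : (s.set r m).set r n = s.set r n := by
  simp [St.set]

theorem St.set_comm {q r : Reg} (h : q ≠ r) (s : St A) (m n : ℕ) :
    (s.set q m).set r n = (s.set r n).set q m := by
  simp [St.set, Function.update_comm h]

/-- Here `g i` describes everything except the counter `r` after `i` rounds. The loop has already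
decreased `r` when the body starts, hence `n - (i + 1)`. -/
theorem exec_whileReg_of_set {r : Reg} {p : Prog (Alph A) (Var A)} (g : ℕ → St A) (T n : ℕ)
    (h : ∀ i < n, Exec p ((g i).set r (n - (i + 1))) ((g (i + 1)).set r (n - (i + 1))) T) :
    Exec (whileReg r p) ((g 0).set r n) ((g n).set r 0) (n * (T + 1) + 1) := by
  have h' := exec_whileReg (r := r) (p := p) (fun i => (g (n - i)).set r i) T n (by simp)
    fun i hi => ⟨by simp, by
      have := h (n - (i + 1)) (by omega)
      rw [show n - (i + 1) + 1 = n - i by omega, show n - (n - i) = i by omega] at this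
      rw [St.set_set]
      simpa using this⟩
  simpa using h'

theorem exec_transfer {q r : Reg} (hqr : q ≠ r) {s : St A} {n : ℕ} (hn : s.reg q = n) :
    Exec (whileReg q (incr r)) s ((s.set r (s.reg r + n)).set q 0) (2 * n + 1) := by
  have h := exec_whileReg_of_set (r := q) (p := incr r) (fun i => s.set r (s.reg r + i)) 1 n
    fun i _ => (exec_incr r _).congr (by
      simp only [St.set_reg, Function.update_self, Function.update_of_ne hqr.symm]
      rw [St.set_comm hqr, St.set_set, Nat.add_assoc])
  simp only [Nat.add_zero, St.set_self] at h
  rw [St.set_eq_self hn] at h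
  exact h.mono (by omega)

/-- Run `p` as many times as the counter `r` says, and preserve this counter. -/
def copy (r : Reg) (p : Prog (Alph A) (Var A)) : Prog (Alph A) (Var A) :=
  (whileReg r ((incr .tmp).seq p)).seq (whileReg .tmp (incr r))

/-- The value of `r` is moved to `tmp` during the rounds and then moved back; so `p` has to work for
arbitrary values of these two counters. -/
theorem exec_copy {r : Reg} {p : Prog (Alph A) (Var A)} (hr : r ≠ .tmp) (g : ℕ → St A) {n : ℕ}
    (hn : ∀ i, (g i).reg r = n) (htmp : ∀ i, (g i).reg .tmp = 0)
    (hp : ∀ i a b, Exec p (((g i).set r a).set .tmp b) (((g (i + 1)).set r a).set .tmp b) 1) :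
    Exec (copy r p) (g 0) (g n) (5 * n + 2) := by
  have h := exec_whileReg_of_set (r := r) (p := (incr .tmp).seq p) (fun i => (g i).set .tmp i) 2 n
    fun i _ => (((exec_incr .tmp _).seq (T' := 1) (by
      simp only [St.set_reg, Function.update_of_ne hr.symm, Function.update_self]
      rw [St.set_comm hr, St.set_set, St.set_comm hr.symm]
      exact hp i _ _)).congr (St.set_comm hr _ _ _))
  have h' := exec_transfer (q := .tmp) (r := r) hr.symm (s := ((g n).set .tmp n).set r 0) (n := n)
    (by simp [hr.symm])
  have h'' := h.seq h'
  simp only [St.set_reg, Function.update_self, Nat.zero_add, St.set_set] at h''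
  rw [St.set_eq_self (htmp 0), St.set_eq_self (hn 0), St.set_comm hr, St.set_set,
    St.set_eq_self (htmp n), St.set_eq_self (hn n)] at h''
  exact h''.mono (by omega)

/-- Write the value of a counter to the stack `out` in unary. -/
def copyOut (r : Reg) : Prog (Alph A) (Var A) := copy r (pushOut .tick)

theorem exec_copyOut {r : Reg} (hr : r ≠ .tmp) {s : St A} (hs : s.reg .tmp = 0) :
    Exec (copyOut r) s { s with out := List.replicate (s.reg r) CircuitSym.tick ++ s.out }
      (5 * s.reg r + 2) :=
  exec_copy hr (fun i => { s with out := List.replicate i CircuitSym.tick ++ s.out })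
    (fun _ => rfl) (fun _ => hs) fun _ _ _ => (exec_pushOut .tick _).congr
      (by simp [St.set, List.replicate_succ])

/-- Add the value of the counter `r` to the counter `q`. -/
def copyReg (r q : Reg) : Prog (Alph A) (Var A) := copy r (incr q)

theorem exec_copyReg {r q : Reg} (hr : r ≠ .tmp) (hq : q ≠ .tmp) (hqr : q ≠ r) {s : St A}
    (hs : s.reg .tmp = 0) :
    Exec (copyReg r q) s (s.set q (s.reg q + s.reg r)) (5 * s.reg r + 2) := by
  have h := exec_copy (p := incr q) hr (fun i => s.set q (s.reg q + i)) (n := s.reg r)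
    (fun _ => by simp [hqr.symm]) (fun _ => by simp [hq.symm, hs]) fun i a b =>
      (exec_incr q _).congr (by
        simp only [St.set_reg, Function.update_of_ne hq, Function.update_of_ne hqr,
          Function.update_self]
        rw [St.set_comm hq.symm, St.set_comm hqr.symm, St.set_set, Nat.add_assoc])
  simp only [Nat.add_zero, St.set_self] at h
  exact h

end Macros

/-! ### Writing gates with relative addresses -/

section Emit

variable {A : Algorithm CircuitSym (Option Bool)}

/-- The state after the gates `rs` have been written. -/
def St.emit (s : St A) (rs : List Rel) : St A :=
  { s with out := ((place (s.reg .wire) rs).flatMap encodeGate).reverse ++ s.out }.set .wire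
    (s.reg .wire + rs.length)

@[simp] theorem St.emit_wire (s : St A) (rs : List Rel) :
    (s.emit rs).reg .wire = s.reg .wire + rs.length := by simp [St.emit]

theorem St.emit_reg (s : St A) (rs : List Rel) {r : Reg} (hr : r ≠ .wire) :
    (s.emit rs).reg r = s.reg r := by simp [St.emit, hr]

theorem St.emit_nil (s : St A) : s.emit [] = s := by
  rw [St.emit, List.length_nil]
  exact St.set_self s .wire

theorem St.emit_append (s : St A) (rs rs' : List Rel) :
    s.emit (rs ++ rs') = (s.emit rs).emit rs' := by
  simp [St.emit, St.set, place_append, Nat.add_assoc]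

theorem St.emit_set {r : Reg} (hr : r ≠ .wire) (s : St A) (n : ℕ) (rs : List Rel) :
    (s.set r n).emit rs = (s.emit rs).set r n := by
  simp [St.emit, St.set, Function.update_of_ne hr.symm, Function.update_comm hr.symm]

/-- As long as the wires stay below `B`, the program `p` writes the gates `rs` in time `T`. The
values of the counters `blocks` and `idx` are `m` and `j`. -/
def Emits (m j B : ℕ) (p : Prog (Alph A) (Var A)) (rs : List Rel) (T : ℕ) : Prop :=
  ∀ s : St A, s.reg .blocks = m → s.reg .idx = j → s.reg .tmp = 0 → 5 * m < s.reg .wire →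
    5 ≤ s.reg .wire → s.reg .wire + rs.length ≤ B → Exec p s (s.emit rs) T

variable {m j B : ℕ}

theorem Emits.seq {p q : Prog (Alph A) (Var A)} {rs rs' : List Rel} {T T' : ℕ}
    (hp : Emits m j B p rs T) (hq : Emits m j B q rs' T') :
    Emits m j B (p.seq q) (rs ++ rs') (T + T') := by
  intro s h₁ h₂ h₃ h₄ h₅ h₆
  rw [List.length_append] at h₆
  rw [St.emit_append]
  refine (hp s h₁ h₂ h₃ h₄ h₅ (by omega)).seq (hq _ ?_ ?_ ?_ ?_ ?_ ?_)
  · rwa [St.emit_reg _ _ (by decide)]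
  · rwa [St.emit_reg _ _ (by decide)]
  · rwa [St.emit_reg _ _ (by decide)]
  · rw [St.emit_wire]; omega
  · rw [St.emit_wire]; omega
  · rw [St.emit_wire]; omega

theorem Emits.mono {p : Prog (Alph A) (Var A)} {rs : List Rel} {T T' : ℕ}
    (hp : Emits m j B p rs T) (hT : T ≤ T') : Emits m j B p rs T' :=
  fun s h₁ h₂ h₃ h₄ h₅ h₆ => (hp s h₁ h₂ h₃ h₄ h₅ h₆).mono hT

theorem Emits.seqList {α : Type} {p : α → Prog (Alph A) (Var A)} {f : α → List Rel} {T : ℕ}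
    {l : List α} (h : ∀ a ∈ l, Emits m j B (p a) (f a) T) :
    Emits m j B (seqList (l.map p)) (l.flatMap f) (l.length * T + 1) := by
  induction l with
  | nil =>
    intro s _ _ _ _ _ _
    rw [List.flatMap_nil, St.emit_nil]
    exact (exec_skip s).mono (by simp)
  | cons a l ih =>
    exact ((h a List.mem_cons_self).seq
      (ih fun b hb => h b (List.mem_cons_of_mem _ hb))).mono (by simp; ring_nf; omega)

/-- Write the number of the wire at distance `c`. -/
def emitRef (c : ℕ) : Prog (Alph A) (Var A) := (copyOut .wire).seq (times c popOut)

/-- Subtraction takes place on the output: `wire` many ticks are written and `c` of them removed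
again. -/
theorem exec_emitRef {c : ℕ} {s : St A} (hs : s.reg .tmp = 0) (hc : c ≤ s.reg .wire) :
    Exec (emitRef c) s
      { s with out := List.replicate (s.reg .wire - c) CircuitSym.tick ++ s.out }
      (5 * s.reg .wire + c + 3) := by
  refine (((exec_copyOut (by decide) hs).seq (exec_times_popOut c _)).congr ?_).mono (by omega)
  obtain ⟨d, hd⟩ := Nat.exists_eq_add_of_le hc
  rw [hd, Nat.add_sub_cancel_left, List.replicate_add, List.append_assoc]
  simp

def emitRel : Rel → Prog (Alph A) (Var A)
  | .and c d => (pushOut .and).seq ((emitRef c).seq ((pushOut .sep).seq ((emitRef d).seq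
      (incr .wire))))
  | .or c d => (pushOut .or).seq ((emitRef c).seq ((pushOut .sep).seq ((emitRef d).seq
      (incr .wire))))
  | .not c => (pushOut .not).seq ((emitRef c).seq (incr .wire))
  | .lit _ => skip

/-- The gate reads wires at distance at most 5. -/
def Rel.Near : Rel → Prop
  | .and c d => c ≤ 5 ∧ d ≤ 5
  | .or c d => c ≤ 5 ∧ d ≤ 5
  | .not c => c ≤ 5
  | .lit _ => False

theorem emits_emitRel {r : Rel} (hr : r.Near) :
    Emits (A := A) m j B (emitRel r) [r] (10 * B + 30) := by
  intro s _ _ h₃ _ h₅ h₆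
  rw [List.length_singleton] at h₆
  cases r with
  | and c d =>
    obtain ⟨hc, hd⟩ := hr
    refine (((exec_pushOut .and s).seq ((exec_emitRef (by exact h₃) (by exact hc.trans h₅)).seq
      ((exec_pushOut .sep _).seq ((exec_emitRef (by exact h₃) (by exact hd.trans h₅)).seq
      (exec_incr .wire _))))).congr ?_).mono (by dsimp only; omega)
    simp [St.emit, place, Rel.at, encodeGate]
  | or c d =>
    obtain ⟨hc, hd⟩ := hr
    refine (((exec_pushOut .or s).seq ((exec_emitRef (by exact h₃) (by exact hc.trans h₅)).seq
      ((exec_pushOut .sep _).seq ((exec_emitRef (by exact h₃) (by exact hd.trans h₅)).seq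
      (exec_incr .wire _))))).congr ?_).mono (by dsimp only; omega)
    simp [St.emit, place, Rel.at, encodeGate]
  | not c =>
    refine (((exec_pushOut .not s).seq ((exec_emitRef (by exact h₃) (by exact le_trans hr h₅)).seq
      (exec_incr .wire _))).congr ?_).mono (by have : c ≤ 5 := hr; dsimp only; omega)
    simp [St.emit, place, Rel.at, encodeGate]
  | lit i => exact hr.elim

def emitRels (rs : List Rel) : Prog (Alph A) (Var A) := seqList (rs.map emitRel)

theorem emits_emitRels {rs : List Rel} (hr : ∀ r ∈ rs, r.Near) :
    Emits (A := A) m j B (emitRels rs) rs (rs.length * (10 * B + 30) + 1) := by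
  have h := Emits.seqList (A := A) (m := m) (j := j) (B := B) (p := emitRel) (f := fun r => [r])
    (fun r h => emits_emitRel (hr r h))
  unfold emitRels
  simpa using h

end Emit

end MaxListing

namespace MaxListing

open Turing

/-! ### Writing the block constraints and translating the clauses of the input -/

section Generator

variable {A : Algorithm CircuitSym (Option Bool)} {m j B : ℕ}

/-- A bound on the time for writing the gates of an instruction. -/
def tokTime (B : ℕ) : ℕ := 50 * B + 200

theorem emits_tok {t : Tok} (ht : ∀ r ∈ t.rels, r.Near) :
    Emits (A := A) m j B (emitRels t.rels) t.rels (tokTime B) := by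
  refine (emits_emitRels ht).mono ?_
  cases t <;> simp [Tok.rels, tokTime] <;> omega

theorem near_fin : ∀ r ∈ Tok.fin.rels, r.Near := by simp [Tok.rels, Rel.Near]

theorem near_mark : ∀ r ∈ Tok.mark.rels, r.Near := by simp [Tok.rels, Rel.Near]

/-- The gates of a literal after the first one. -/
def litTail (b : Bool) : List Rel := [.not 1, .or 5 5, .or 5 5, .or 5 (bif b then 3 else 4)]

theorem near_litTail (b : Bool) : ∀ r ∈ litTail b, r.Near := by
  cases b <;> simp [litTail, Rel.Near]

/-- Write the gates of a literal of the block that the counter `idx` says. -/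
def blockLit (b : Bool) (r : ℕ) : Prog (Alph A) (Var A) :=
  ((pushOut .not).seq ((copyOut .idx).seq ((times r (copyOut .blocks)).seq (incr .wire)))).seq
    (emitRels (litTail b))

theorem exec_times_copyOut {q : Reg} (hq : q ≠ .tmp) {s : St A} (hs : s.reg .tmp = 0) (r : ℕ) :
    Exec (times r (copyOut q)) s
      { s with out := List.replicate (r * s.reg q) CircuitSym.tick ++ s.out }
      (r * (5 * s.reg q + 2) + 1) := by
  have h := exec_times (p := copyOut q)
    (fun i => { s with out := List.replicate (i * s.reg q) CircuitSym.tick ++ s.out })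
    (5 * s.reg q + 2) r fun i _ => (exec_copyOut hq (by exact hs)).congr (by
      simp only [St.mk.injEq, true_and, and_true]
      rw [Nat.succ_mul, Nat.add_comm, List.replicate_add, List.append_assoc])
  simpa using h

/-- Row 5 is allowed besides the rows 0 to 4 of a block, because `5 * m + 0` is the last element of
the ground set. -/
theorem emits_blockLit (b : Bool) {r : ℕ} (hr : r ≤ 5) (hj : j ≤ m) :
    Emits (A := A) m j B (blockLit b r) (Tok.lit b (r * m + j)).rels (tokTime B) := by
  have h : Emits (A := A) m j B ((pushOut .not).seq ((copyOut .idx).seq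
      ((times r (copyOut .blocks)).seq (incr .wire)))) [.lit (r * m + j)] (6 * B + 20) := by
    intro s h₁ h₂ h₃ h₄ _ h₆
    refine (((exec_pushOut .not s).seq ((exec_copyOut (by decide) (by exact h₃)).seq
      ((exec_times_copyOut (by decide) (by exact h₃) r).seq (exec_incr .wire _)))).congr
      ?_).mono ?_
    · dsimp only
      rw [h₁, h₂]
      simp only [St.emit, place, Rel.at, encodeGate, List.flatMap_cons, List.flatMap_nil,
        List.append_nil, List.reverse_cons, List.reverse_replicate, List.append_assoc,
        List.singleton_append, List.length_singleton]
      rw [List.replicate_add, List.append_assoc]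
    · dsimp only
      rw [h₁, h₂]
      have := Nat.mul_le_mul_right (5 * m + 2) hr
      omega
  refine (h.seq (emits_emitRels (near_litTail b))).mono ?_
  simp only [litTail, List.length_cons, List.length_nil, tokTime]
  omega

/-- Write the gates of the clauses of the block that the counter `idx` says. -/
def blockProg (b : Bool) : Prog (Alph A) (Var A) :=
  seqList (template.map fun c => (seqList (c.map (blockLit b))).seq (emitRels Tok.fin.rels))

theorem emits_blockProg (b : Bool) (hj : j ≤ m) :
    Emits (A := A) m j B (blockProg b) ((clauseToks (blockClauses b m j)).flatMap Tok.rels)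
      (36 * tokTime B) := by
  have h : ∀ c ∈ template, Emits (A := A) m j B
      ((seqList (c.map (blockLit b))).seq (emitRels Tok.fin.rels))
      (c.flatMap (fun r => (Tok.lit b (r * m + j)).rels) ++ Tok.fin.rels)
      (5 * tokTime B + 1) := by
    intro c hc
    have h₁ : ∀ c ∈ template, c.length ≤ 4 ∧ ∀ r ∈ c, r ≤ 5 := by decide
    refine ((Emits.seqList fun r hr => emits_blockLit b ((h₁ c hc).2 r hr) hj).seq
      (emits_tok near_fin)).mono ?_
    have := Nat.mul_le_mul_right (tokTime B) (h₁ c hc).1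
    omega
  have h' := Emits.seqList h
  have e : (clauseToks (blockClauses b m j)).flatMap Tok.rels =
      template.flatMap fun c => c.flatMap (fun r => (Tok.lit b (r * m + j)).rels) ++ Tok.fin.rels := by
    simp [clauseToks, blockClauses, List.flatMap_assoc, List.flatMap_map, List.flatMap_append,
      Function.comp_def]
  rw [e]
  refine h'.mono ?_
  simp only [template, List.length_cons, List.length_nil, tokTime]
  omega

/-- The counter is decreased before the body runs, so the blocks are written from `k - 1` down to 0,
in the order of `blocks`. -/
theorem exec_blocks (b : Bool) {k : ℕ} (hk : k ≤ m) {s : St A} (h₁ : s.reg .blocks = m)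
    (h₂ : s.reg .idx = k) (h₃ : s.reg .tmp = 0) (h₄ : 5 * m < s.reg .wire) (h₅ : 5 ≤ s.reg .wire)
    (h₆ : s.reg .wire + ((clauseToks (blocks b m k)).flatMap Tok.rels).length ≤ B) :
    Exec (whileReg .idx (blockProg b)) s
      ((s.emit ((clauseToks (blocks b m k)).flatMap Tok.rels)).set .idx 0)
      (k * (36 * tokTime B + 1) + 1) := by
  induction k generalizing s with
  | zero =>
    refine (exec_whileReg_zero h₂).congr ?_ |>.mono (by omega)
    simp only [blocks, clauseToks, List.flatMap_nil, St.emit_nil]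
    rw [St.set_eq_self h₂]
  | succ k ih =>
    have e : (clauseToks (blocks b m (k + 1))).flatMap Tok.rels =
        (clauseToks (blockClauses b m k)).flatMap Tok.rels ++
          (clauseToks (blocks b m k)).flatMap Tok.rels := by
      simp [blocks, clauseToks]
    rw [e, List.length_append] at h₆
    have hp := emits_blockProg (A := A) (B := B) b (Nat.le_of_succ_le hk)
      (s.set .idx (s.reg .idx - 1)) (by simpa using h₁) (by simp [h₂]) (by simpa using h₃)
      (by simpa using h₄) (by simpa using h₅)
      (by simp only [St.set_reg, Function.update_of_ne (show Reg.wire ≠ .idx by decide)]; omega)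
    refine ((exec_whileReg_succ (by omega) hp (ih (Nat.le_of_succ_le hk) ?_ ?_ ?_ ?_ ?_ ?_)).congr
      ?_).mono (by ring_nf; omega)
    · rw [St.emit_reg _ _ (by decide)]; simpa using h₁
    · rw [St.emit_reg _ _ (by decide)]; simp [h₂]
    · rw [St.emit_reg _ _ (by decide)]; simpa using h₃
    all_goals try
      rw [St.emit_wire, St.set_reg, Function.update_of_ne (by decide)]
      omega
    · rw [e, St.emit_append, St.emit_set (by decide), St.emit_set (by decide), St.set_set]

/-- The part of the encoding of a formula that stands for an instruction. -/
def Tok.code : Tok → List CNFSym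
  | .lit b i => (if b then CNFSym.pos else CNFSym.neg) :: List.replicate i CNFSym.tick
  | .fin => [CNFSym.sep]
  | .mark => []

/-- Read a literal and write its gates. -/
def readLit (b : Bool) : Prog (Alph A) (Var A) :=
  ((pushOut .not).seq ((whileTick (pushOut .tick)).seq (incr .wire))).seq (emitRels (litTail b))

theorem exec_whileTick {p : Prog (Alph A) (Var A)} (g : ℕ → St A) (T n : ℕ) {l : List CNFSym}
    (hl : l.head? ≠ some .tick)
    (h : ∀ i, ∀ inp, Exec p { g i with inp := inp } { g (i + 1) with inp := inp } T) :
    Exec (whileTick p) { g 0 with inp := List.replicate n CNFSym.tick ++ l } { g n with inp := l }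
      (n * (T + 1) + 1) := by
  induction n generalizing g with
  | zero => exact (exec_whileTick_exit (by exact hl)).mono (by omega)
  | succ n ih =>
    refine (exec_whileTick_step (s := { g 0 with inp := List.replicate (n + 1) CNFSym.tick ++ l })
      (l := List.replicate n CNFSym.tick ++ l) rfl (h 0 _)
      (ih (fun i => g (i + 1)) fun i => h _)).mono ?_
    ring_nf
    omega

/-- Variable `i` is input wire `i`, and both indices are in unary, so the ticks of the formula are
copied unchanged into the first gate. -/
theorem exec_readLit (b : Bool) {i : ℕ} {l : List CNFSym} (hl : l.head? ≠ some .tick) {s : St A}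
    (hs : s.inp = List.replicate i CNFSym.tick ++ l) (h₃ : s.reg .tmp = 0)
    (h₄ : 5 * s.reg .blocks < s.reg .wire)
    (h₅ : 5 ≤ s.reg .wire) (h₆ : s.reg .wire + 5 ≤ B) (h₇ : i ≤ B) :
    Exec (readLit b) s ({ s with inp := l }.emit (Tok.lit b i).rels) (tokTime B) := by
  have h : Exec ((pushOut .not).seq ((whileTick (pushOut .tick)).seq (incr .wire))) s
      ({ s with inp := l }.emit [.lit i]) (2 * i + 3) := by
    have hw := exec_whileTick (p := pushOut .tick) (fun k => { s with
      out := List.replicate k CircuitSym.tick ++ CircuitSym.not :: s.out }) 1 i hl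
      fun k inp => (exec_pushOut .tick _).congr (by simp [List.replicate_succ])
    rw [← hs] at hw
    refine (((exec_pushOut .not s).seq (hw.seq (exec_incr .wire _))).congr ?_).mono (by omega)
    simp [St.emit, place, Rel.at, encodeGate]
  have h' := emits_emitRels (A := A) (m := s.reg .blocks) (j := s.reg .idx) (B := B)
    (near_litTail b) ({ s with inp := l }.emit [.lit i]) (by rw [St.emit_reg _ _ (by decide)])
    (by rw [St.emit_reg _ _ (by decide)]) (by rw [St.emit_reg _ _ (by decide)]; exact h₃)
    (by rw [St.emit_wire]; simp only; omega) (by rw [St.emit_wire]; simp only; omega)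
    (by rw [St.emit_wire]; simp only [litTail, List.length_cons, List.length_nil]; omega)
  rw [← St.emit_append] at h'
  refine (h.seq h').mono ?_
  simp only [litTail, List.length_cons, List.length_nil, tokTime]
  omega

/-- Read the clauses of a formula and write their gates. -/
def readClauses : Prog (Alph A) (Var A) := forInp fun x => match x with
  | .tick => skip
  | .pos => readLit true
  | .neg => readLit false
  | .sep => emitRels Tok.fin.rels

/-- The unary index of a literal ends where the next instruction begins. A mark has an empty code
and would break this. -/
theorem head?_code {ts : List Tok} (ht : .mark ∉ ts) :
    (ts.flatMap Tok.code).head? ≠ some .tick := by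
  rcases ts with _ | ⟨⟨b, i⟩ | _ | _, ts⟩
  · simp
  · cases b <;> simp [Tok.code]
  · simp [Tok.code]
  · simp at ht

theorem exec_readClauses {ts : List Tok} (ht : .mark ∉ ts) (hB : ∀ t ∈ ts, t.Below B) {s : St A}
    (hs : s.inp = ts.flatMap Tok.code) (h₃ : s.reg .tmp = 0)
    (h₄ : 5 * s.reg .blocks < s.reg .wire)
    (h₅ : 5 ≤ s.reg .wire) (h₆ : s.reg .wire + (ts.flatMap Tok.rels).length ≤ B) :
    Exec readClauses s ({ s with inp := [] }.emit (ts.flatMap Tok.rels))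
      (ts.length * (tokTime B + 1) + 1) := by
  induction ts generalizing s with
  | nil =>
    refine (exec_forInp_nil hs).congr ?_ |>.mono (by omega)
    rw [List.flatMap_nil, St.emit_nil, ← show s.inp = [] from hs]
  | cons t ts ih =>
    have ht' : Tok.mark ∉ ts := fun h => ht (List.mem_cons_of_mem _ h)
    have hB' : ∀ t ∈ ts, t.Below B := fun t h => hB t (List.mem_cons_of_mem _ h)
    rw [List.flatMap_cons] at hs h₆
    rw [List.length_append] at h₆
    have hl := head?_code ht'
    have key : ∀ (x : CNFSym) (l : List CNFSym), s.inp = x :: l →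
        Exec (match x with
          | .tick => skip
          | .pos => readLit true
          | .neg => readLit false
          | .sep => emitRels Tok.fin.rels) { s with inp := l }
          ({ s with inp := ts.flatMap Tok.code }.emit t.rels) (tokTime B) →
        Exec readClauses s ({ s with inp := [] }.emit ((t :: ts).flatMap Tok.rels))
          ((t :: ts).length * (tokTime B + 1) + 1) := by
      intro x l hx hp
      refine ((exec_forInp_cons hx hp (ih ht' hB' ?_ ?_ ?_ ?_ ?_)).congr ?_).mono ?_
      · rfl
      · rwa [St.emit_reg _ _ (by decide)]
      · rw [St.emit_reg _ _ (by decide), St.emit_wire]; exact h₄.trans_le (Nat.le_add_right _ _)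
      · rw [St.emit_wire]; exact h₅.trans (Nat.le_add_right _ _)
      · rw [St.emit_wire, Nat.add_assoc]; exact h₆
      · rw [List.flatMap_cons, St.emit_append]
        rfl
      · rw [List.length_cons]; ring_nf; omega
    cases t with
    | lit b i =>
      have h5 : (Tok.lit b i).rels.length = 5 := rfl
      have hi : i < B := hB _ List.mem_cons_self
      cases b
      · exact key .neg _ hs (exec_readLit false hl rfl h₃ h₄ h₅ (by simp only; omega) hi.le)
      · exact key .pos _ hs (exec_readLit true hl rfl h₃ h₄ h₅ (by simp only; omega) hi.le)
    | fin =>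
      exact key .sep _ hs (emits_tok near_fin _ rfl rfl h₃ h₄ h₅ (by simp only; omega))
    | mark => exact (ht List.mem_cons_self).elim

/-- The number of blocks for a formula with `n` variables. -/
def numBlocks (n₀ n : ℕ) : ℕ := n₀ + (n + 2) / 3

/-- Read the number of variables of a formula and compute the number of blocks. -/
def readHeader (n₀ : ℕ) : Prog (Alph A) (Var A) :=
  (whileTick (incr .idx)).seq (popInp.seq ((times n₀ (incr .blocks)).seq
    (whileReg .idx ((decr .idx).seq ((decr .idx).seq (incr .blocks))))))

/-- A round takes 3 from `idx`, one by the loop and two by its body. Decrements stop at 0, so the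
quotient is rounded up. -/
theorem exec_divide {n b : ℕ} {s : St A} (hn : s.reg .idx = n) (hb : s.reg .blocks = b) :
    Exec (whileReg .idx ((decr .idx).seq ((decr .idx).seq (incr .blocks)))) s
      ((s.set .blocks (b + (n + 2) / 3)).set .idx 0) (4 * n + 1) := by
  induction n using Nat.strong_induction_on generalizing s b with
  | _ n ih =>
    rcases Nat.eq_zero_or_pos n with rfl | hpos
    · refine (exec_whileReg_zero hn).congr ?_
      rw [St.set_comm (by decide), St.set_eq_self hn, St.set_eq_self (by omega)]
    · refine ((exec_whileReg_succ (by omega) ((exec_decr .idx _).seq ((exec_decr .idx _).seq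
        (exec_incr .blocks _))) (ih (n - 3) (by omega) (b := b + 1) ?_ ?_)).congr ?_).mono ?_
      · simp [hn]
        omega
      · simp [hb]
      · rw [show b + 1 + (n - 3 + 2) / 3 = b + (n + 2) / 3 by omega]
        simp [St.set, Function.update_comm (show Reg.idx ≠ Reg.blocks by decide)]
      · omega

theorem exec_readHeader (n₀ n : ℕ) {s : St A} {l : List CNFSym}
    (hs : s.inp = List.replicate n CNFSym.tick ++ .sep :: l) (h₁ : s.reg .blocks = 0)
    (h₂ : s.reg .idx = 0) :
    Exec (readHeader n₀) s ({ s with inp := l }.set .blocks (numBlocks n₀ n))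
      (6 * n + n₀ + 4) := by
  have hw := exec_whileTick (p := incr .idx) (l := .sep :: l) (fun k => s.set .idx k) 1 n (by simp)
    fun k inp => (exec_incr .idx _).congr (by simp [St.set])
  rw [St.set_eq_self h₂, ← hs] at hw
  refine ((hw.seq ((exec_popInp _).seq ((exec_times_incr n₀ .blocks _).seq
    (exec_divide (n := n) (b := n₀) ?_ ?_)))).congr ?_).mono (by omega)
  · simp
  · simp [h₁]
  · refine St.ext' rfl rfl rfl (fun r => ?_) rfl
    cases r <;> simp [numBlocks, h₂]

end Generator

end MaxListing

namespace MaxListing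

open Turing

/-! ### The phases of the decider: building the circuit, setting the clock, evaluating the answer -/

section Decider

variable {A : Algorithm CircuitSym (Option Bool)} {m B : ℕ}

/-- Write the gates of all blocks. -/
def allBlocks (b : Bool) : Prog (Alph A) (Var A) :=
  (copyReg .blocks .idx).seq (whileReg .idx (blockProg b))

theorem emits_allBlocks (b : Bool) :
    Emits (A := A) m 0 B (allBlocks b) ((clauseToks (blocks b m m)).flatMap Tok.rels)
      (42 * m * (tokTime B + 1) + 3) := by
  intro s h₁ h₂ h₃ h₄ h₅ h₆
  refine (((exec_copyReg (by decide) (by decide) (by decide) h₃).seq (exec_blocks (m := m) (k := m)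
    (B := B) b le_rfl ?_ ?_ ?_ ?_ ?_ ?_)).congr ?_).mono ?_
  · simpa using h₁
  · simp [h₁, h₂]
  · simpa using h₃
  · simpa using h₄
  · simpa using h₅
  · rw [St.set_reg, Function.update_of_ne (by decide)]
    exact h₆
  · rw [St.emit_set (by decide), St.set_set, St.set_eq_self]
    rw [St.emit_reg _ _ (by decide), h₂]
  · rw [h₁]
    ring_nf
    omega

/-- Write all gates of the circuit. -/
def writeGates : Prog (Alph A) (Var A) :=
  ((emitRels [.and 0 0, .not 1, .and 0 0]).seq ((allBlocks true).seq
    ((emitRels Tok.mark.rels).seq ((allBlocks false).seq ((blockLit false 5).seq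
      (emitRels Tok.fin.rels)))))).seq (readClauses.seq (emitRels [.or 3 2]))

theorem length_le_flatMap_rels (ts : List Tok) : ts.length ≤ (ts.flatMap Tok.rels).length := by
  induction ts with
  | nil => simp
  | cons t ts ih =>
    rw [List.flatMap_cons, List.length_append, List.length_cons]
    have : 1 ≤ t.rels.length := by cases t <;> simp [Tok.rels]
    omega

theorem not_mark_mem_clauseToks (cls : List (List (Bool × ℕ))) : Tok.mark ∉ clauseToks cls := by
  simp [clauseToks]

theorem exec_writeGates (hm : 0 < m) {cls : List (List (Bool × ℕ))}
    (hcls : ∀ c ∈ cls, ∀ l ∈ c, l.2 < 5 * m) {s : St A}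
    (hs : s.inp = (clauseToks cls).flatMap Tok.code)
    (h₁ : s.reg .blocks = m) (h₂ : s.reg .idx = 0) (h₃ : s.reg .tmp = 0)
    (h₄ : s.reg .wire = 5 * m + 1) (hB : B = 5 * m + 1 + (gadgetRels m cls).length) :
    Exec writeGates s ({ s with inp := [] }.emit (gadgetRels m cls))
      (100 * (B + 1) * (tokTime B + 1)) := by
  have E := (emits_emitRels (A := A) (m := m) (j := 0) (B := B) (rs := [.and 0 0, .not 1, .and 0 0])
    (by simp [Rel.Near])).seq ((emits_allBlocks true).seq
    ((emits_tok near_mark).seq ((emits_allBlocks false).seq ((emits_blockLit false le_rfl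
      m.zero_le).seq (emits_tok near_fin)))))
  -- The unit clause that excludes the last element is written as a literal of row 5 in block 0,
  -- since `idx` is back at 0.
  have e : gadgetRels m cls = ([Rel.and 0 0, .not 1, .and 0 0] ++
      ((clauseToks (blocks true m m)).flatMap Tok.rels ++ (Tok.mark.rels ++
        ((clauseToks (blocks false m m)).flatMap Tok.rels ++ ((Tok.lit false (5 * m + 0)).rels ++
          Tok.fin.rels))))) ++ ((clauseToks cls).flatMap Tok.rels ++ [.or 3 2]) := by
    simp [gadgetRels, gadgetToks, clauseToks, List.flatMap_append]
  rw [e] at hB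
  rw [e, St.emit_append, St.emit_append]
  set rs₁ := ([Rel.and 0 0, .not 1, .and 0 0] ++
      ((clauseToks (blocks true m m)).flatMap Tok.rels ++ (Tok.mark.rels ++
        ((clauseToks (blocks false m m)).flatMap Tok.rels ++ ((Tok.lit false (5 * m + 0)).rels ++
          Tok.fin.rels))))) with hrs₁
  set rs₂ := (clauseToks cls).flatMap Tok.rels with hrs₂
  rw [List.length_append (as := rs₁), List.length_append (as := rs₂), List.length_singleton] at hB
  have hlen := length_le_flatMap_rels (clauseToks cls)
  rw [← hrs₂] at hlen
  have E₁ := E s h₁ h₂ h₃ (by omega) (by omega) (by omega)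
  have E₂ := exec_readClauses (A := A) (B := B) (not_mark_mem_clauseToks cls)
    (below_clauseToks fun c hc l hl => (hcls c hc l hl).trans_le (by omega)) (s := s.emit rs₁) hs
    (by rwa [St.emit_reg _ _ (by decide)])
    (by rw [St.emit_reg _ _ (by decide), St.emit_wire]; omega)
    (by rw [St.emit_wire]; omega) (by rw [St.emit_wire, ← hrs₂]; omega)
  have E₃ := emits_emitRels (A := A) (m := m) (j := 0) (B := B) (rs := [.or 3 2])
    (by simp [Rel.Near]) (({ s with inp := [] }.emit rs₁).emit rs₂)
    (by rw [St.emit_reg _ _ (by decide), St.emit_reg _ _ (by decide)]; exact h₁)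
    (by rw [St.emit_reg _ _ (by decide), St.emit_reg _ _ (by decide)]; exact h₂)
    (by rw [St.emit_reg _ _ (by decide), St.emit_reg _ _ (by decide)]; exact h₃)
    (by rw [St.emit_wire, St.emit_wire]; simp only; omega)
    (by rw [St.emit_wire, St.emit_wire]; simp only; omega)
    (by rw [St.emit_wire, St.emit_wire, List.length_singleton]; simp only; omega)
  refine (E₁.seq (E₂.seq E₃)).mono ?_
  have hmB : m ≤ B := by omega
  have hcB : (clauseToks cls).length ≤ B := by omega
  have h1 := Nat.mul_le_mul_right (tokTime B + 1) hmB
  have h2 := Nat.mul_le_mul_right (tokTime B + 1) hcB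
  have h3 : 10 * B + 30 ≤ tokTime B := by unfold tokTime; omega
  simp only [List.length_cons, List.length_nil]
  have h4 : 42 * m * (tokTime B + 1) = 42 * (m * (tokTime B + 1)) := Nat.mul_assoc _ _ _
  have h5 : 100 * (B + 1) * (tokTime B + 1) = 100 * (B * (tokTime B + 1)) + 100 * (tokTime B + 1) := by
    ring
  omega

/-- Write the size of the ground set. -/
def writeInputs : Prog (Alph A) (Var A) :=
  (times 5 (copyReg .blocks .wire)).seq ((incr .wire).seq (copyOut .wire))

theorem exec_writeInputs {s : St A} (h₁ : s.reg .blocks = m) (h₃ : s.reg .tmp = 0)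
    (h₄ : s.reg .wire = 0) :
    Exec writeInputs s { s with out := List.replicate (5 * m + 1) CircuitSym.tick ++ s.out
                                reg := Function.update s.reg .wire (5 * m + 1) }
      (50 * m + 30) := by
  have h := exec_times (p := copyReg .blocks .wire) (fun i => s.set .wire (i * m)) (5 * m + 2) 5
    fun i _ => ((exec_copyReg (by decide) (by decide) (by decide)
      (by simpa using h₃)).congr (by
        simp [h₁, St.set, Nat.succ_mul])).mono (by simp [h₁])
  have h0 : s.set .wire (0 * m) = s := by rw [Nat.zero_mul, St.set_eq_self h₄]
  rw [h0] at h
  refine ((h.seq ((exec_incr .wire _).seq (exec_copyOut (by decide) (by simpa using h₃)))).congr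
    ?_).mono ?_
  · simp [St.set]
  · simp
    omega

/-- Move the encoding of the circuit to the input stack of the simulated machine. -/
def loadInput : Prog (Alph A) (Var A) :=
  forOut fun x => pushExt A.tm.k₀ (A.inputAlphabet.symm x)

/-- The stack `out` has the last symbol on top; the reversal here puts the first symbol of the
circuit on top of the input of `A`. -/
theorem exec_loadInput {l : List CircuitSym} {s : St A} (hs : s.out = l) :
    Exec loadInput s { s with out := [], sim := Function.update s.sim A.tm.k₀ <|
      (l.map A.inputAlphabet.symm).reverse ++ s.sim A.tm.k₀ } (2 * l.length + 1) := by
  induction l generalizing s with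
  | nil =>
    exact (exec_forOut_nil hs).congr (St.ext' rfl hs rfl (fun _ => rfl) (by simp))
  | cons x l ih =>
    exact ((exec_forOut_cons hs (exec_pushExt _ _ _) (ih rfl)).congr (by simp)).mono
      (by simp; omega)

/-- Multiply the clock by 7. -/
def mulClock : Prog (Alph A) (Var A) :=
  (whileReg .clock (times 7 (incr .tmp))).seq (whileReg .tmp (incr .clock))

theorem exec_mulClock {c : ℕ} {s : St A} (hc : s.reg .clock = c) (h₃ : s.reg .tmp = 0) :
    Exec mulClock s (s.set .clock (7 * c)) (23 * c + 2) := by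
  have h := exec_whileReg_of_set (r := .clock) (p := times 7 (incr .tmp))
    (fun i => s.set .tmp (7 * i)) 8 c fun i _ => (exec_times_incr 7 .tmp _).congr (by
      simp only [St.set_reg, Function.update_of_ne (show Reg.tmp ≠ .clock by decide),
        Function.update_self]
      rw [St.set_comm (by decide), St.set_set, Nat.mul_succ])
  rw [Nat.mul_zero, St.set_eq_self h₃, St.set_eq_self hc] at h
  refine ((h.seq (exec_transfer (by decide) (n := 7 * c) (by simp))).congr ?_).mono (by omega)
  simp only [St.set_reg, Function.update_self, Nat.zero_add, St.set_set]
  rw [St.set_comm (by decide), St.set_set, St.set_comm (by decide), St.set_comm (by decide),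
    St.set_eq_self h₃]

/-- Set the clock to `7 ^ m`, where `m` is the number of blocks. -/
def setClock : Prog (Alph A) (Var A) :=
  (incr .clock).seq ((copyReg .blocks .idx).seq (whileReg .idx mulClock))

theorem exec_setClock {s : St A} (h₁ : s.reg .blocks = m) (h₂ : s.reg .idx = 0)
    (h₃ : s.reg .tmp = 0) (hc : s.reg .clock = 0) :
    Exec setClock s (s.set .clock (7 ^ m)) (40 * (m + 1) * 7 ^ m) := by
  have hpos : 0 < 7 ^ m := by positivity
  have h := exec_whileReg_of_set (r := .idx) (p := mulClock)
    (fun i => s.set .clock (7 ^ i)) (23 * 7 ^ m + 2) m fun i hi =>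
      ((exec_mulClock (c := 7 ^ i) (by simp) (by simpa using h₃)).congr (by
        rw [St.set_comm (by decide), St.set_set, Nat.pow_succ, Nat.mul_comm])).mono (by
        have := Nat.pow_le_pow_right (show 0 < 7 by decide) hi.le
        omega)
  rw [Nat.pow_zero] at h
  refine (((exec_incr .clock s).seq ((exec_copyReg (by decide) (by decide) (by decide)
    (by simpa using h₃)).seq (s'' := (s.set .clock (7 ^ m)).set .idx 0)
      (T' := m * (23 * 7 ^ m + 2 + 1) + 1) ?_)).congr ?_).mono ?_
  · simpa [hc, h₁, h₂] using h
  · rw [St.set_eq_self (by simpa using h₂)]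
  · simp only [St.set_reg, Function.update_of_ne (show Reg.blocks ≠ .clock by decide), h₁]
    have : m ≤ m * 7 ^ m := Nat.le_mul_of_pos_right m hpos
    ring_nf
    omega

/-- What remains of the answer is scanned for sets that do not contain the last element; `t` says
whether the last bit has been `false`, and `i` counts these sets. -/
def scan : List (Option Bool) → ℕ × ℕ → ℕ × ℕ
  | [], s => s
  | some b :: l, (_, i) => scan l ((!b).toNat, i)
  | none :: l, (t, i) => scan l (0, i + t)

/-- Scan the answer of the simulated machine. -/
def scanAnswer : Prog (Alph A) (Var A) := forAnswer fun x => match x with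
  | some true => decr .tmp
  | some false => (decr .tmp).seq (incr .tmp)
  | none => whileReg .tmp (incr .idx)

/-- Since `t ≤ 1`, a decrement clears `tmp`, and a decrement followed by an increment sets it to 1.
At a terminator `tmp` is moved to `idx`. -/
theorem exec_scanAnswer {l : List (Option Bool)} {s : St A} {t i : ℕ} (ht : t ≤ 1)
    (hs : s.sim A.tm.k₁ = l.map A.outputAlphabet.symm) (h₂ : s.reg .idx = i)
    (h₃ : s.reg .tmp = t) :
    Exec scanAnswer s (({ s with sim := Function.update s.sim A.tm.k₁ [] }.set .tmp
      (scan l (t, i)).1).set .idx (scan l (t, i)).2) (4 * l.length + 1) := by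
  induction l generalizing s t i with
  | nil =>
    refine (exec_forAnswer_nil hs).congr ?_
    rw [scan, St.set_eq_self (by simpa using h₂), St.set_eq_self (by exact h₃)]
    rw [List.map_nil] at hs
    rw [← hs, Function.update_eq_self]
  | cons x l ih =>
    have hT : ∀ T ≤ 3, T + (4 * l.length + 1) + 1 ≤ 4 * (x :: l).length + 1 := by
      intro T hT
      rw [List.length_cons]
      omega
    rcases x with _ | _ | _
    · refine ((exec_forAnswer_cons (x := none) hs (exec_transfer (by decide) (n := t) (by exact h₃))
        (ih (t := 0) (i := i + t) zero_le_one (by simp) ?_ ?_)).congr ?_).mono (hT _ (by omega))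
      · simp [h₂]
      · simp
      · refine St.ext' rfl rfl rfl (fun r => ?_) (by simp)
        cases r <;> simp [scan]
    · refine ((exec_forAnswer_cons (x := some false) hs ((exec_decr .tmp _).seq (exec_incr .tmp _))
        (ih (t := 1) (i := i) le_rfl (by simp) ?_ ?_)).congr ?_).mono (hT _ (by omega))
      · simp [h₂]
      · simp [h₃]
        omega
      · refine St.ext' rfl rfl rfl (fun r => ?_) (by simp)
        cases r <;> simp [scan]
    · refine ((exec_forAnswer_cons (x := some true) hs (exec_decr .tmp _)
        (ih (t := 0) (i := i) zero_le_one (by simp) ?_ ?_)).congr ?_).mono (hT _ (by omega))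
      · simp [h₂]
      · simp [h₃]
        omega
      · refine St.ext' rfl rfl rfl (fun r => ?_) (by simp)
        cases r <;> simp [scan]

/-- Write the result. -/
def writeResult : Prog (Alph A) (Var A) :=
  (pushRes false).seq (whileReg .idx (popRes.seq (pushRes true)))

theorem exec_writeResult {s : St A} {i : ℕ} (h₂ : s.reg .idx = i) (hr : s.res = []) :
    Exec writeResult s ({ s with res := [decide (i ≠ 0)] }.set .idx 0) (3 * i + 2) := by
  have h := exec_whileReg_of_set (r := .idx) (p := popRes.seq (pushRes true))
    (fun k => { s with res := [decide (k ≠ 0)] }) 2 i fun k _ =>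
      ((exec_popRes _).seq (exec_pushRes true _)).congr (by simp [St.set])
  refine Exec.mono (T := 1 + (i * (2 + 1) + 1)) (Exec.seq (exec_pushRes false s) ?_) (by omega)
  rw [St.set_eq_self (by exact h₂)] at h
  simpa [hr] using h

/-- Run the simulated machine and decide whether it lists a set that does not contain the last
element. If it does not halt in time, the answer is `true`. -/
def answer : Prog (Alph A) (Var A) :=
  (incr .idx).seq ((simulate A).seq ((whileReg .done ((decr .idx).seq scanAnswer)).seq writeResult))

theorem scan_le (l : List (Option Bool)) {t i : ℕ} (ht : t ≤ 1) :
    (scan l (t, i)).2 ≤ i + l.length := by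
  induction l generalizing t i with
  | nil => simp [scan]
  | cons x l ih =>
    rcases x with _ | b
    · have := ih (t := 0) (i := i + t) zero_le_one
      simp only [scan, List.length_cons]
      omega
    · have := ih (t := (!b).toNat) (i := i) (by cases b <;> decide)
      simp only [scan, List.length_cons]
      omega

/-- `done` is 1, so the loop runs once: it revokes the preset 1 in `idx` and replaces it by the
number of listed sets without the last element. -/
theorem exec_answer_of_le {s : St A} {t : ℕ} {x : A.tm.σ} {S : ∀ k, List (A.tm.Γ k)}
    {l : List (Option Bool)}
    (h : StepsTo A.tm.m t ⟨some A.tm.main, A.tm.initialState, s.sim⟩ ⟨none, x, S⟩)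
    (hc : t ≤ s.reg .clock) (hS : S A.tm.k₁ = l.map A.outputAlphabet.symm)
    (h₂ : s.reg .idx = 0) (h₃ : s.reg .tmp = 0) (hd : s.reg .done = 0) (hr : s.res = []) :
    ∃ s' : St A, s'.res = [decide ((scan l (0, 0)).2 ≠ 0)] ∧
      Exec answer s s' (s.reg .clock + 7 * l.length + 20) := by
  have h1 := exec_simulate_of_le (s := s.set .idx (s.reg .idx + 1)) h (by simpa using hc)
  set s₁ := ({ s.set .idx (s.reg .idx + 1) with sim := S }.set .clock
    ((s.set .idx (s.reg .idx + 1)).reg .clock - t)).set .done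
      ((s.set .idx (s.reg .idx + 1)).reg .done + 1) with hs₁
  have h2 := exec_scanAnswer (l := l) (t := 0) (i := 0)
    (s := (s₁.set .done (s₁.reg .done - 1)).set .idx
      ((s₁.set .done (s₁.reg .done - 1)).reg .idx - 1)) zero_le_one
    (by simp [hs₁, hS]) (by simp [hs₁, h₂]) (by simp [hs₁, h₃])
  have h3 := exec_whileReg_succ (r := .done) (p := (decr .idx).seq scanAnswer) (s := s₁)
    (by simp [hs₁]) ((exec_decr .idx _).seq h2) (exec_whileReg_zero (by simp [hs₁, hd]))
  have h4 := (exec_incr .idx s).seq (h1.seq (h3.seq (exec_writeResult rfl (by simp [hs₁, hr]))))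
  refine ⟨_, ?_, h4.mono ?_⟩
  · simp
  · have := scan_le l (t := 0) (i := 0) zero_le_one
    simp
    omega

/-- `done` is still 0, so the scan is skipped and the preset 1 in `idx` makes the answer `true`. -/
theorem exec_answer_of_lt {s : St A} {t : ℕ} {x : A.tm.σ} {S : ∀ k, List (A.tm.Γ k)}
    (h : StepsTo A.tm.m t ⟨some A.tm.main, A.tm.initialState, s.sim⟩ ⟨none, x, S⟩)
    (hc : s.reg .clock < t) (h₂ : s.reg .idx = 0) (hd : s.reg .done = 0) (hr : s.res = []) :
    ∃ s' : St A, s'.res = [true] ∧ Exec answer s s' (s.reg .clock + 20) := by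
  obtain ⟨S', h1⟩ := exec_simulate_of_lt (s := s.set .idx (s.reg .idx + 1)) h (by simpa using hc)
  have h4 := (exec_incr .idx s).seq (h1.seq ((exec_whileReg_zero (r := .done)
    (p := (decr .idx).seq scanAnswer) (by simp [hd])).seq (exec_writeResult (i := 1)
      (by simp [h₂]) (by simp [hr]))))
  refine ⟨_, ?_, h4.mono ?_⟩
  · simp
  · simp
    omega

end Decider

end MaxListing

namespace MaxListing

open Turing

/-! ### The complete machine and its correctness -/

section Machine

variable {A : Algorithm CircuitSym (Option Bool)}

variable (A) in
/-- Decide a formula by listing the maximal solutions of its gadget with `A`. -/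
def decider (n₀ : ℕ) : Prog (Alph A) (Var A) :=
  (readHeader n₀).seq (writeInputs.seq (writeGates.seq (loadInput.seq (setClock.seq answer))))

/-- The clauses of a formula, with the variables as natural numbers. -/
def CNF.clauses {n : ℕ} (φ : CNF n) : List (List (Bool × ℕ)) :=
  φ.map fun c => c.map fun l => (l.1, (l.2 : ℕ))

theorem CNF.lt_of_mem_clauses {n : ℕ} {φ : CNF n} : ∀ c ∈ φ.clauses, ∀ l ∈ c, l.2 < n := by
  intro c hc l hl
  obtain ⟨c', -, rfl⟩ := List.mem_map.1 hc
  obtain ⟨l', -, rfl⟩ := List.mem_map.1 hl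
  exact l'.2.2

theorem CNF.satisfiable_iff {n : ℕ} {φ : CNF n} :
    φ.Satisfiable ↔ ∃ v : ℕ → Bool, holds v φ.clauses = true := by
  have h : ∀ v : ℕ → Bool,
      holds v φ.clauses = true ↔ ∀ c ∈ φ, ∃ l ∈ c, v (l.2 : ℕ) = l.1 := fun v => by
    simp [holds, CNF.clauses]
  simp only [h]
  constructor
  · rintro ⟨v, hv⟩
    refine ⟨fun i => if h : i < n then v ⟨i, h⟩ else false, fun c hc => ?_⟩
    obtain ⟨l, hl, h⟩ := hv c hc
    exact ⟨l, hl, by simpa using h⟩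
  · rintro ⟨v, hv⟩
    exact ⟨fun i => v i, hv⟩

theorem encodeCNF_eq {n : ℕ} (φ : CNF n) :
    encodeCNF φ = List.replicate n .tick ++ .sep :: (clauseToks φ.clauses).flatMap Tok.code := by
  simp only [encodeCNF, clauseToks, CNF.clauses, List.flatMap_map, List.flatMap_assoc,
    List.flatMap_append, List.flatMap_singleton, Tok.code]
  rfl

theorem scan_append (l l' : List (Option Bool)) (s : ℕ × ℕ) :
    scan (l ++ l') s = scan l' (scan l s) := by
  induction l generalizing s with
  | nil => rfl
  | cons x l ih =>
    obtain ⟨t, i⟩ := s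
    rcases x with _ | b
    · exact ih _
    · exact ih _

theorem scan_map_some (l : List Bool) (t i : ℕ) : ∃ t', scan (l.map some) (t, i) = (t', i) := by
  induction l generalizing t with
  | nil => exact ⟨t, rfl⟩
  | cons b l ih => exact ih _

/-- Every bit overwrites the flag of the previous one, so at a terminator the flag speaks of the
last element. -/
theorem scan_encodeSets {m : ℕ} (L : List (Finset (Fin (m + 1)))) (i : ℕ) :
    (scan (encodeSets L) (0, i)).2 = i + (L.map fun X => (!chi X m).toNat).sum := by
  induction L generalizing i with
  | nil => rfl
  | cons X L ih =>
    have e : encodeSets (X :: L) =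
        (List.ofFn fun i : Fin m => decide (i.castSucc ∈ X)).map some ++
          (some (chi X m) :: none :: encodeSets L) := by
      have hlast : chi X m = decide (Fin.last m ∈ X) := chi_coe X (Fin.last m)
      rw [hlast, encodeSets, List.flatMap_cons, List.ofFn_succ', List.concat_eq_append,
        List.map_ofFn, List.append_assoc, List.append_assoc]
      rfl
    obtain ⟨t', ht'⟩ := scan_map_some (List.ofFn fun i : Fin m => decide (i.castSucc ∈ X)) 0 i
    rw [e, scan_append, ht', scan, scan, ih, List.map_cons, List.sum_cons, Nat.add_assoc]

theorem scan_encodeSets_ne_zero {m : ℕ} (L : List (Finset (Fin (m + 1)))) :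
    (scan (encodeSets L) (0, 0)).2 ≠ 0 ↔ ∃ X ∈ L, chi X m = false := by
  rw [scan_encodeSets, Nat.zero_add, Ne, List.sum_eq_zero_iff]
  simp

/-- The initial state. -/
def St.init (x : List CNFSym) : St A := ⟨x, [], [], fun _ => 0, fun _ => []⟩

variable (A) in
/-- The program `p` as a machine that reads the stack `inp` and writes the stack `res`. -/
def Prog.toAlgorithm (p : Prog (Alph A) (Var A)) : Algorithm CNFSym Bool :=
  letI := p.fin
  letI := A.tm.kFin
  letI := A.tm.σFin
  letI : Fintype (Alph A (.inl .inp)) := inferInstanceAs (Fintype CNFSym)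
  { tm :=
      { K := Own ⊕ A.tm.K
        k₀ := .inl .inp
        k₁ := .inl .res
        Γ := Alph A
        Λ := p.Λ
        main := p.entry
        σ := Var A
        initialState := (none, A.tm.initialState)
        m := p.code }
    inputAlphabet := Equiv.refl CNFSym
    outputAlphabet := Equiv.refl Bool }

theorem Exec.outputs {p : Prog (Alph A) (Var A)} {x : List CNFSym} {s' : St A} {T : ℕ}
    (h : Exec p (St.init x) s' T) : ∃ t ≤ T, (Prog.toAlgorithm A p).Outputs x s'.res t := by
  obtain ⟨v', t, ht, h'⟩ := h (none, A.tm.initialState)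
  refine ⟨t, ht, ⟨none, v', s'.stk⟩, ?_, rfl, (List.map_id _).symm⟩
  refine Eq.trans (congrArg _ (congrArg some ?_)) h'
  refine congrArg (TM2.Cfg.mk _ _) ?_
  funext k
  rcases k with (_ | _ | _ | r) | k
  · exact List.map_id _
  all_goals rfl

theorem initList_stk (x : List CircuitSym) :
    (initList A.tm (x.map A.inputAlphabet.symm)).stk =
      Function.update (fun _ => []) A.tm.k₀ (x.map A.inputAlphabet.symm) := by
  funext k
  by_cases hk : k = A.tm.k₀
  · subst hk
    simp [initList]
  · simp [initList, hk]

/-- A bound on the running time of the decider, where `m` is the number of blocks, `B` the number of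
wires, `E` the length of the encoding of the circuit, and `c` bounds the number of symbols that `A`
pushes in a step. -/
def deciderTime (c n₀ n m B E : ℕ) : ℕ :=
  (6 * n + n₀ + 4) + ((50 * m + 30) + (100 * (B + 1) * (tokTime B + 1) + ((2 * E + 1) +
    (40 * (m + 1) * 7 ^ m + (7 ^ m + 7 * (E + c * 7 ^ m) + 20)))))

/-- The final phase is left open as a continuation, because it differs according to whether `A`
halts before the clock expires. -/
theorem exec_prepare {n₀ n : ℕ} (φ : CNF n) (h₀ : 0 < n₀) :
    let m := numBlocks n₀ n
    let C := gadget m φ.clauses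
    ∃ s : St A, s.sim = (initList A.tm ((encodeCircuit C).map A.inputAlphabet.symm)).stk ∧
      s.reg .clock = 7 ^ m ∧ s.reg .idx = 0 ∧ s.reg .tmp = 0 ∧ s.reg .done = 0 ∧ s.res = [] ∧
      ∀ (q : St A) (T : ℕ), Exec answer s q T → Exec (decider A n₀) (St.init (encodeCNF φ)) q
        ((6 * n + n₀ + 4) + ((50 * m + 30) + (100 * (5 * m + 1 + C.gates.length + 1) *
          (tokTime (5 * m + 1 + C.gates.length) + 1) + ((2 * (encodeCircuit C).length + 1) +
            (40 * (m + 1) * 7 ^ m + T))))) := by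
  intro m C
  have hm : n ≤ 3 * m := by
    simp only [m, numBlocks]
    omega
  have hm0 : 0 < m := by
    simp only [m, numBlocks]
    omega
  have h1 := exec_readHeader (A := A) n₀ n (s := St.init (encodeCNF φ)) (encodeCNF_eq φ) rfl rfl
  have h2 := exec_writeInputs (A := A) (m := m) (s := { St.init (encodeCNF φ) with
    inp := (clauseToks φ.clauses).flatMap Tok.code }.set .blocks (numBlocks n₀ n))
    (by simp [m]) rfl rfl
  obtain ⟨s₂, hs₂, h2⟩ : ∃ s₂, s₂ = _ ∧ Exec writeInputs _ s₂ _ := ⟨_, rfl, h2⟩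
  have h3 := exec_writeGates (A := A) (m := m) (cls := φ.clauses)
    (B := 5 * m + 1 + C.gates.length) (s := s₂) hm0
    (fun c hc l hl => (CNF.lt_of_mem_clauses c hc l hl).trans_le (by omega))
    (by simp [hs₂]) (by simp [hs₂, m]) (by simp [hs₂, St.init]) (by simp [hs₂, St.init]) (by simp [hs₂])
    (by simp only [C, gadget, length_place])
  have hout : ({ s₂ with inp := [] }.emit (gadgetRels m φ.clauses)).out =
      (encodeCircuit C).reverse := by
    simp [St.emit, hs₂, St.init, encodeCircuit, C, gadget]
  have h4 := exec_loadInput hout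
  obtain ⟨s₄, hs₄, h4⟩ : ∃ s₄, s₄ = _ ∧ Exec loadInput _ s₄ _ := ⟨_, rfl, h4⟩
  have hsim : s₄.sim = (initList A.tm ((encodeCircuit C).map A.inputAlphabet.symm)).stk := by
    rw [initList_stk]
    simp [hs₄, St.emit, hs₂, St.init, List.map_reverse]
  have h5 := exec_setClock (m := m) (s := s₄) (by simp [hs₄, St.emit, hs₂, m])
    (by simp [hs₄, St.emit, hs₂, St.init]) (by simp [hs₄, St.emit, hs₂, St.init])
    (by simp [hs₄, St.emit, hs₂, St.init])
  refine ⟨s₄.set .clock (7 ^ m), hsim, by simp, by simp [hs₄, St.emit, hs₂, St.init],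
    by simp [hs₄, St.emit, hs₂, St.init], by simp [hs₄, St.emit, hs₂, St.init],
    by simp [hs₄, St.emit, hs₂, St.init], fun q T h6 => ?_⟩
  rw [List.length_reverse] at h4
  exact h1.seq (h2.seq (h3.seq (h4.seq (h5.seq h6))))

theorem exists_outputs_decider {d n₀ : ℕ} (h₀ : 0 < n₀)
    (hA : ListsMaximal (fun _ F => IsIndependence F) d A) :
    ∃ c : ℕ, ∀ (n : ℕ) (φ : CNF n),
      let m := numBlocks n₀ n
      let C := gadget m φ.clauses
      (encodeCircuit C).length ≤ (5 * m + 1) ^ d + d →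
      (¬φ.Satisfiable → ∀ y t, A.Outputs (encodeCircuit C) y t → t ≤ 7 ^ m) →
      ∃ (b : Bool) (t : ℕ), (b = true ↔ φ.Satisfiable) ∧
        (Prog.toAlgorithm A (decider A n₀)).Outputs (encodeCNF φ) [b] t ∧
        t ≤ deciderTime c n₀ n m (5 * m + 1 + C.gates.length) (encodeCircuit C).length := by
  let := A.tm.ΛFin
  obtain ⟨c, hc⟩ := exists_length_le A.tm.m
  refine ⟨c, fun n φ => ?_⟩
  intro m C hE hclock
  have hm : n ≤ 3 * m := by
    simp only [m, numBlocks]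
    omega
  have hm0 : 0 < m := by
    simp only [m, numBlocks]
    omega
  have hcls3 : ∀ c ∈ φ.clauses, ∀ l ∈ c, l.2 < 3 * m := fun c hc l hl =>
    (CNF.lt_of_mem_clauses c hc l hl).trans_le hm
  have hcls5 : ∀ c ∈ φ.clauses, ∀ l ∈ c, l.2 < 5 * m := fun c hc l hl =>
    (hcls3 c hc l hl).trans_le (by omega)
  obtain ⟨L, t, hL, -, hmem⟩ := hA (5 * m + 1) C ⟨isIndependence_gadget hm0 hcls5, hE⟩
  have hsat : (∃ X ∈ L, chi X (5 * m) = false) ↔ φ.Satisfiable := by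
    rw [CNF.satisfiable_iff]
    constructor
    · rintro ⟨X, hX, hlast⟩
      exact ⟨_, holds_of_maximal hcls5 ((hmem X).1 hX) hlast⟩
    · rintro ⟨v, hv⟩
      obtain ⟨X, hX, hlast⟩ := exists_maximal_of_holds hcls3 hv
      exact ⟨X, (hmem X).2 hX, hlast⟩
  obtain ⟨s, hsim, hck, hidx, htmp, hdone, hres, hs⟩ := exec_prepare (A := A) φ h₀
  have hL' := hL
  obtain ⟨⟨_, x, S⟩, hrun, rfl, hS⟩ := hL'
  have hrun' : StepsTo A.tm.m t ⟨some A.tm.main, A.tm.initialState, s.sim⟩ ⟨none, x, S⟩ := by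
    rw [hsim]
    exact hrun
  by_cases ht : t ≤ 7 ^ m
  · obtain ⟨s', hs', h'⟩ := exec_answer_of_le hrun' (ht.trans_eq hck.symm) hS hidx htmp hdone hres
    obtain ⟨t', ht', hout⟩ := (hs _ _ h').outputs
    refine ⟨_, t', ?_, hs' ▸ hout, ht'.trans ?_⟩
    · rw [decide_eq_true_iff, scan_encodeSets_ne_zero, hsat]
    · have h1 := hc t _ _ hrun A.tm.k₁
      have h2 : ((initList A.tm ((encodeCircuit C).map A.inputAlphabet.symm)).stk A.tm.k₁).length ≤
          (encodeCircuit C).length := by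
        rw [initList_stk]
        by_cases hk : A.tm.k₁ = A.tm.k₀
        · rw [hk]
          simp
        · simp [hk]
      -- In at most 7^m steps `A` cannot have written more than this, so scanning the answer fits
      -- into the time bound.
      have h3 : (encodeSets L).length ≤ (encodeCircuit C).length + c * 7 ^ m := by
        have h4 := Nat.mul_le_mul_left c ht
        have h5 := congrArg List.length hS
        rw [List.length_map] at h5
        rw [← h5]
        exact h1.trans (Nat.add_le_add h2 h4)
      rw [deciderTime, hck]
      simp only [C, m] at h3 ⊢
      omega
  · obtain ⟨s', hs', h'⟩ := exec_answer_of_lt hrun' (hck.trans_lt (not_le.1 ht)) hidx hdone hres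
    obtain ⟨t', ht', hout⟩ := (hs _ _ h').outputs
    refine ⟨true, t', ?_, hs' ▸ hout, ht'.trans ?_⟩
    -- On an unsatisfiable formula `A` would have halted within 7^m steps.
    · simp only [true_iff]
      by_contra hn
      exact ht (hclock hn _ _ hL)
    · rw [deciderTime, hck]
      simp only [C, m]
      omega

end Machine

end MaxListing

namespace MaxListing

/-! ### The sizes of the circuit and of the formula -/

section Size

theorem length_flatMap_le {α β : Type} {f : α → List β} {l : List α} {b : ℕ}
    (h : ∀ a ∈ l, (f a).length ≤ b) : (l.flatMap f).length ≤ l.length * b := by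
  induction l with
  | nil => simp
  | cons a l ih =>
    rw [List.flatMap_cons, List.length_append, List.length_cons, Nat.succ_mul, Nat.add_comm]
    exact Nat.add_le_add (ih fun a' h' => h a' (List.mem_cons_of_mem _ h')) (h a List.mem_cons_self)

theorem length_rels_le (t : Tok) : t.rels.length ≤ 5 := by
  cases t <;> simp [Tok.rels]

theorem length_clauseToks_append (cls cls' : List (List (Bool × ℕ))) :
    (clauseToks (cls ++ cls')).length = (clauseToks cls).length + (clauseToks cls').length := by
  simp [clauseToks]

/-- The template has 22 literals in 7 clauses, and every clause adds one `fin`. -/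
theorem length_clauseToks_blocks (b : Bool) (m k : ℕ) :
    (clauseToks (blocks b m k)).length = 29 * k := by
  induction k with
  | zero => rfl
  | succ k ih =>
    rw [blocks, length_clauseToks_append, ih, Nat.mul_succ, Nat.add_comm]
    rfl

theorem length_clauseToks_clauses_lt {n : ℕ} (φ : CNF n) :
    (clauseToks φ.clauses).length < (encodeCNF φ).length := by
  have h : ∀ ts : List Tok, .mark ∉ ts → ts.length ≤ (ts.flatMap Tok.code).length := by
    intro ts ht
    induction ts with
    | nil => simp
    | cons t ts ih =>
      rw [List.mem_cons, not_or] at ht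
      have h1 : 1 ≤ t.code.length := by
        cases t
        · simp [Tok.code]
        · simp [Tok.code]
        · exact (ht.1 rfl).elim
      have h2 := ih ht.2
      rw [List.flatMap_cons, List.length_append, List.length_cons]
      omega
  have := h _ (not_mark_mem_clauseToks φ.clauses)
  rw [encodeCNF_eq, List.length_append, List.length_cons]
  omega

theorem length_gadgetRels_le {n : ℕ} (m : ℕ) (φ : CNF n) :
    (gadgetRels m φ.clauses).length ≤ 290 * m + 5 * (encodeCNF φ).length + 14 := by
  have h1 := length_flatMap_le (f := Tok.rels) (l := gadgetToks m φ.clauses) (b := 5)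
    fun t _ => length_rels_le t
  have h2 := length_clauseToks_clauses_lt φ
  have h3 : (clauseToks [[(false, 5 * m)]]).length = 2 := rfl
  have h4 : (gadgetToks m φ.clauses).length = 58 * m + 3 + (clauseToks φ.clauses).length := by
    rw [gadgetToks, List.length_append, List.length_cons, length_clauseToks_append,
      length_clauseToks_append, length_clauseToks_blocks, length_clauseToks_blocks, h3]
    omega
  simp only [gadgetRels, List.length_append, List.length_cons, List.length_nil]
  omega

theorem length_encode_place_le {rs : List Rel} {w M : ℕ} (h : ∀ i, .lit i ∈ rs → i ≤ M)
    (hM : w + rs.length ≤ M) :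
    ((place w rs).flatMap encodeGate).length ≤ rs.length * (2 * M + 2) := by
  induction rs generalizing w with
  | nil => simp [place]
  | cons r rs ih =>
    rw [List.length_cons] at hM
    have h1 := ih (w := w + 1) (fun i hi => h i (List.mem_cons_of_mem _ hi)) (by omega)
    have h2 : (encodeGate (r.at w)).length ≤ 2 * M + 2 := by
      cases r with
      | lit i =>
        have := h i List.mem_cons_self
        simp [Rel.at, encodeGate]
        omega
      | _ =>
        simp [Rel.at, encodeGate]
        omega
    rw [place, List.flatMap_cons, List.length_append, List.length_cons, Nat.succ_mul]
    omega

/-- With B wires, at most B gates of length at most 2B + 2 and the unary ground set give B(2B + 2) +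
B ≤ 5B². -/
theorem length_encode_gadget_le {m : ℕ} {cls : List (List (Bool × ℕ))}
    (hcls : ∀ c ∈ cls, ∀ l ∈ c, l.2 < 5 * m) :
    (encodeCircuit (gadget m cls)).length ≤ 5 * (5 * m + 1 + (gadget m cls).gates.length) ^ 2 := by
  have h := length_encode_place_le (rs := gadgetRels m cls) (w := 5 * m + 1) (fun i hi => ?_) le_rfl
  · simp only [gadget, length_place]
    set B := 5 * m + 1 + (gadgetRels m cls).length with hB
    have hG : (gadgetRels m cls).length ≤ B := by omega
    rw [encodeCircuit, List.length_append, List.length_replicate]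
    have h2 := h.trans (Nat.mul_le_mul_right _ hG)
    have h3 : 1 ≤ B := by omega
    simp only at h2 ⊢
    nlinarith
  · have hlit : ∃ t ∈ gadgetToks m cls, .lit i ∈ t.rels := by
      simpa [gadgetRels] using hi
    obtain ⟨t, ht, hi⟩ := hlit
    have hlt := below_gadgetToks (fun c hc l hl => (hcls c hc l hl).trans (Nat.lt_succ_self _)) t ht
    cases t with
    | lit b j =>
      have : i = j := by simpa [Tok.rels] using hi
      simp only [Tok.Below] at hlt
      omega
    | _ => simp [Tok.rels] at hi

/-- A clause with at most `k` literals is a word of length `k` over the 2n literals and a blank, and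
the clauses are distinct. -/
theorem length_le_of_isKCNF {n k : ℕ} {φ : CNF n} (h : φ.IsKCNF k) :
    φ.length ≤ (2 * n + 1) ^ k := by
  classical
  rw [← List.toFinset_card_of_nodup h.1]
  have := Finset.card_le_card_of_injOn (s := φ.toFinset)
    (t := (Finset.univ : Finset (Fin k → Option (Bool × Fin n))))
    (fun l i => l[(i : ℕ)]?) (fun _ _ => Finset.mem_univ _) ?_
  · simpa [Finset.card_univ] using this
  · intro c hc c' hc' hcc
    have hc := h.2 c (by simpa using hc)
    have hc' := h.2 c' (by simpa using hc')
    refine List.ext_getElem? fun i => ?_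
    by_cases hi : i < k
    · exact congrFun hcc ⟨i, hi⟩
    · rw [List.getElem?_eq_none (by omega), List.getElem?_eq_none (by omega)]

theorem length_encodeCNF_le {n k : ℕ} {φ : CNF n} (h : φ.IsKCNF k) :
    (encodeCNF φ).length ≤ n + 1 + (2 * n + 1) ^ k * (k * n + 1) := by
  have h1 := length_flatMap_le (f := fun c => c.flatMap encodeLiteral ++ [CNFSym.sep]) (l := φ)
    (b := k * n + 1) fun c hc => by
      have := length_flatMap_le (f := encodeLiteral (n := n)) (l := c) (b := n) fun l _ => by
        have := l.2.2
        simp [encodeLiteral]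
      have := this.trans (Nat.mul_le_mul_right n (h.2 c hc))
      simpa using this
  have := h1.trans (Nat.mul_le_mul_right _ (length_le_of_isKCNF h))
  rw [encodeCNF, List.length_append, List.length_cons, List.length_replicate]
  omega

/-- The exponent depends only on `k`: constants are absorbed by N ≥ 6, the formula has length at
most 2N^(3k+1), and the circuit has at most N^(3k+4) wires. -/
theorem length_encode_gadget_le_pow {n k m : ℕ} {φ : CNF n} (h : φ.IsKCNF k) (hm : 0 < m)
    (hn : n ≤ 3 * m) :
    (encodeCircuit (gadget m φ.clauses)).length ≤ (5 * m + 1) ^ (6 * k + 11) := by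
  have h1 := length_encode_gadget_le (m := m) (cls := φ.clauses) fun c hc l hl =>
    (CNF.lt_of_mem_clauses c hc l hl).trans_le (by omega)
  have h2 := length_gadgetRels_le m φ
  have h3 := length_encodeCNF_le h
  simp only [gadget, length_place] at h1
  set N := 5 * m + 1 with hN
  have hN6 : 6 ≤ N := by omega
  have hk : k + 1 ≤ N ^ k := (Nat.lt_pow_self (by decide : 1 < 2)).trans_le
    (Nat.pow_le_pow_left (by omega) k)
  have h4 : (2 * n + 1) ^ k ≤ N ^ (2 * k) := by
    rw [pow_mul]
    exact Nat.pow_le_pow_left (by nlinarith) k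
  have h5 : k * n + 1 ≤ N ^ (k + 1) := by
    rw [pow_succ]
    calc k * n + 1 ≤ (k + 1) * N := by nlinarith
      _ ≤ N ^ k * N := Nat.mul_le_mul_right N hk
  have h6 : (encodeCNF φ).length ≤ 2 * N ^ (3 * k + 1) := by
    have h7 : (2 * n + 1) ^ k * (k * n + 1) ≤ N ^ (3 * k + 1) := by
      rw [show 3 * k + 1 = 2 * k + (k + 1) by ring, pow_add]
      exact Nat.mul_le_mul h4 h5
    have h8 : N ≤ N ^ (3 * k + 1) := Nat.le_self_pow (by omega) N
    omega
  have h9 : N + (gadgetRels m φ.clauses).length ≤ N ^ (3 * k + 4) := by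
    have h8 : N ≤ N ^ (3 * k + 1) := Nat.le_self_pow (by omega) N
    have h10 : N ^ (3 * k + 4) = N ^ (3 * k + 1) * N ^ 3 := by
      rw [← pow_add]
    have h11 : 6 ^ 3 ≤ N ^ 3 := Nat.pow_le_pow_left hN6 3
    have h12 := Nat.mul_le_mul_left (N ^ (3 * k + 1)) h11
    omega
  calc _ ≤ 5 * (N + (gadgetRels m φ.clauses).length) ^ 2 := h1
    _ ≤ N * (N ^ (3 * k + 4)) ^ 2 := Nat.mul_le_mul (by omega) (Nat.pow_le_pow_left h9 2)
    _ = N ^ (6 * k + 9) := by ring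
    _ ≤ N ^ (6 * k + 11) := Nat.pow_le_pow_right (by omega) (by omega)

end Size

/-! ### Estimates of the running time -/

section Time

theorem deciderTime_le {c n₀ n m B E : ℕ} (hn : n ≤ 3 * m) (h₀ : n₀ ≤ m) (hm : m < B)
    (hE : E ≤ 5 * B ^ 2) : deciderTime c n₀ n m B E ≤ (60000 + 7 * c) * B ^ 2 * 7 ^ m := by
  have h7 : 1 ≤ 7 ^ m := Nat.one_le_pow _ _ (by decide)
  have hB : B ≤ B ^ 2 := Nat.le_self_pow (by decide) B
  have h1 : B ^ 2 * 1 ≤ B ^ 2 * 7 ^ m := Nat.mul_le_mul_left _ h7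
  have h2 : (m + 1) * 7 ^ m ≤ B ^ 2 * 7 ^ m := Nat.mul_le_mul_right _ (by omega)
  have h3 : (B + 1) * (tokTime B + 1) ≤ 502 * B ^ 2 := by
    unfold tokTime
    nlinarith
  have h4 : 1 * (c * 7 ^ m) ≤ B ^ 2 * (c * 7 ^ m) := Nat.mul_le_mul_right _ (by omega)
  have h5 : 1 * 7 ^ m ≤ B ^ 2 * 7 ^ m := Nat.mul_le_mul_right _ (by omega)
  have e : (60000 + 7 * c) * B ^ 2 * 7 ^ m =
      60000 * (B ^ 2 * 7 ^ m) + 7 * (B ^ 2 * (c * 7 ^ m)) := by ring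
  rw [deciderTime, e, Nat.mul_assoc 100, Nat.mul_assoc 40]
  omega

theorem pow_numBlocks_le (n₀ n : ℕ) :
    (7 : ℝ) ^ numBlocks n₀ n ≤ 7 ^ (n₀ + 1) * (2 : ℝ) ^ ((19 / 20 : ℝ) * n) := by
  have h1 : numBlocks n₀ n ≤ n₀ + 1 + n / 3 := by
    unfold numBlocks
    omega
  -- 57/20 is three times 19/20, as a block holds three variables; the claim is 7^20 ≤ 2^57.
  have h2 : (7 : ℝ) ≤ (2 : ℝ) ^ (57 / 20 : ℝ) := by
    have : (7 : ℝ) ^ 20 ≤ ((2 : ℝ) ^ (57 / 20 : ℝ)) ^ 20 := by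
      rw [← Real.rpow_mul_natCast zero_le_two]
      norm_num
    exact le_of_pow_le_pow_left₀ (by decide) (by positivity) this
  refine (pow_le_pow_right₀ (by norm_num) h1).trans ?_
  rw [pow_add]
  refine mul_le_mul_of_nonneg_left ?_ (by positivity)
  refine (pow_le_pow_left₀ (by norm_num) h2 _).trans ?_
  rw [← Real.rpow_mul_natCast zero_le_two]
  refine Real.rpow_le_rpow_of_exponent_le one_le_two ?_
  have h3 : ((n / 3 : ℕ) : ℝ) * 3 ≤ n := by exact_mod_cast Nat.div_mul_le_self n 3
  linarith

/-- The constant is 384 = 32 · 2 · 6, with 32 from the number of maximal solutions, 2 from rounding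
up the factor of the last element, and 6 from absorbing m into (7/6)^m. -/
theorem mul_rpow_le_pow {m q a : ℕ} (hq : q ≤ 5 * m + 1) (ha : a ≤ 32 * m) :
    1 / 384 * (a : ℝ) * (2 : ℝ) ^ ((q : ℝ) / 2) ≤ 7 ^ m := by
  have h1 : (2 : ℝ) ^ ((q : ℝ) / 2) ≤ 2 * 6 ^ m := by
    have h2 : (2 : ℝ) ^ (5 / 2 : ℝ) ≤ 6 := by
      have : ((2 : ℝ) ^ (5 / 2 : ℝ)) ^ 2 ≤ 6 ^ 2 := by
        rw [← Real.rpow_mul_natCast zero_le_two]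
        norm_num
      exact le_of_pow_le_pow_left₀ (by decide) (by norm_num) this
    calc (2 : ℝ) ^ ((q : ℝ) / 2) ≤ 2 ^ (1 + (5 / 2 : ℝ) * m) := by
          refine Real.rpow_le_rpow_of_exponent_le one_le_two ?_
          have : (q : ℝ) ≤ 5 * m + 1 := by exact_mod_cast hq
          linarith
      _ = 2 * ((2 : ℝ) ^ (5 / 2 : ℝ)) ^ m := by
          rw [Real.rpow_add two_pos, Real.rpow_one, Real.rpow_mul_natCast zero_le_two]
      _ ≤ 2 * 6 ^ m := by gcongr
  have h3 : (m : ℝ) * 6 ^ m ≤ 6 * 7 ^ m := by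
    -- Bernoulli's inequality: (7/6)^m ≥ 1 + m/6.
    have h := one_add_mul_le_pow (show (-2 : ℝ) ≤ 1 / 6 by norm_num) m
    have e : (7 : ℝ) ^ m = (1 + 1 / 6) ^ m * 6 ^ m := by
      rw [← mul_pow]
      norm_num
    rw [e]
    have h6 : (0 : ℝ) < 6 ^ m := by positivity
    nlinarith
  have ha' : (a : ℝ) ≤ 32 * m := by exact_mod_cast ha
  calc 1 / 384 * (a : ℝ) * (2 : ℝ) ^ ((q : ℝ) / 2) ≤ 1 / 384 * (32 * m) * (2 * 6 ^ m) := by gcongr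
    _ = 1 / 6 * (m * 6 ^ m) := by ring
    _ ≤ 7 ^ m := by linarith

theorem deciderTime_gadget_le (c n₀ : ℕ) : ∃ K : ℕ, ∀ (n : ℕ) (φ : CNF n),
    let m := numBlocks n₀ n
    let C := gadget m φ.clauses
    0 < m →
    (deciderTime c n₀ n m (5 * m + 1 + C.gates.length) (encodeCircuit C).length : ℝ) ≤
      K * ((encodeCNF φ).length + 1 : ℝ) ^ K * (2 : ℝ) ^ ((19 / 20 : ℝ) * n) := by
  -- The circuit has at most 295m + 5|φ| + 15 wires, and m ≤ n₀ + n; so `D * x` bounds their number.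
  set D := 295 * (n₀ + 1) + 20 with hD
  refine ⟨(60000 + 7 * c) * D ^ 2 * 7 ^ (n₀ + 1), fun n φ => ?_⟩
  intro m C hm
  set K := (60000 + 7 * c) * D ^ 2 * 7 ^ (n₀ + 1) with hK
  set x := (encodeCNF φ).length + 1 with hx
  have hn : n ≤ 3 * m := by
    simp only [m, numBlocks]
    omega
  have h₀ : n₀ ≤ m := by
    simp only [m, numBlocks]
    omega
  have hnx : n + 2 ≤ x := by
    rw [hx, encodeCNF, List.length_append, List.length_cons, List.length_replicate]
    omega
  have hB : 5 * m + 1 + C.gates.length ≤ D * x := by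
    have h1 : C.gates.length ≤ _ := (length_place _ _).trans_le (length_gadgetRels_le m φ)
    have h2 : m ≤ n₀ + n := by
      simp only [m, numBlocks] at hm ⊢
      omega
    have h3 : D * x = 295 * (n₀ * x) + 315 * x := by
      rw [hD]
      ring
    have h4 : n₀ * 1 ≤ n₀ * x := Nat.mul_le_mul_left _ (by omega)
    omega
  have h1 := deciderTime_le (c := c) hn h₀ (B := 5 * m + 1 + C.gates.length) (by omega)
    (length_encode_gadget_le (m := m) (cls := φ.clauses) fun c hc l hl =>
      (CNF.lt_of_mem_clauses c hc l hl).trans_le (by omega))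
  have h2 := h1.trans (Nat.mul_le_mul_right _ (Nat.mul_le_mul_left _ (Nat.pow_le_pow_left hB 2)))
  have h3 := pow_numBlocks_le n₀ n
  -- `K` is both the factor and the exponent, and the exponent has to cover the square of the number
  -- of wires.
  have hK2 : 2 ≤ K := by
    have hD1 : 0 < D ^ 2 * 7 ^ (n₀ + 1) := by positivity
    rw [hK, Nat.mul_assoc]
    nlinarith
  have hx1 : (1 : ℝ) ≤ x := by exact_mod_cast (by omega : 1 ≤ x)
  have hxc : ((encodeCNF φ).length + 1 : ℝ) = x := by
    rw [hx]
    push_cast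
    rfl
  rw [hxc]
  calc (deciderTime c n₀ n m (5 * m + 1 + C.gates.length) (encodeCircuit C).length : ℝ)
      ≤ (((60000 + 7 * c) * (D * x) ^ 2 * 7 ^ m : ℕ) : ℝ) := by exact_mod_cast h2
    _ = (60000 + 7 * c) * D ^ 2 * x ^ 2 * 7 ^ m := by
      push_cast
      ring
    _ ≤ (60000 + 7 * c) * D ^ 2 * x ^ K * (7 ^ (n₀ + 1) * (2 : ℝ) ^ ((19 / 20 : ℝ) * n)) := by
      gcongr
    _ = K * (x : ℝ) ^ K * (2 : ℝ) ^ ((19 / 20 : ℝ) * n) := by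
      rw [hK]
      push_cast
      ring

end Time

/-! ### The lower bound for both classes -/

section Main

theorem IsIndependence.isStronglyAccessible {U : Type} [DecidableEq U] {F : Set (Finset U)}
    (h : IsIndependence F) : IsStronglyAccessible F := by
  refine ⟨h.1, fun X Y _ hY hXY => ?_⟩
  obtain ⟨z, hz, hzX⟩ := Finset.exists_of_ssubset hXY
  exact ⟨z, Finset.mem_sdiff.2 ⟨hz, hzX⟩, h.2 _ Y (Finset.insert_subset hz hXY.1) hY⟩

/-- All constructed instances are independence systems, so any class that contains these inherits
the bound. -/
theorem listingLowerBound_of_isIndependence (hSETH : SETH)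
    {P : ∀ N : ℕ, Set (Finset (Fin N)) → Prop} (hP : ∀ N F, IsIndependence F → P N F) :
    ListingLowerBound P := by
  obtain ⟨k, hk⟩ := hSETH (19 / 20) (by norm_num)
  refine ⟨6 * k + 11, fun A hA => ⟨1 / 384, by norm_num, fun q₀ => ?_⟩⟩
  by_contra hfast
  apply hk
  have hA' : ListsMaximal (fun _ F => IsIndependence F) (6 * k + 11) A :=
    fun N C hC => hA N C ⟨hP _ _ hC.1, hC.2⟩
  -- With m ≥ q₀ + 2 blocks, q ≥ 5m − 4 is at least q₀, and m ≥ 2 gives N = 5m + 1 ≤ 2q.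
  obtain ⟨c, hc⟩ := exists_outputs_decider (n₀ := q₀ + 2) (by omega) hA'
  obtain ⟨K, hK⟩ := deciderTime_gadget_le c (q₀ + 2)
  refine ⟨Prog.toAlgorithm A (decider A (q₀ + 2)), K, fun n φ hφ => ?_⟩
  have hm : q₀ + 2 ≤ numBlocks (q₀ + 2) n := Nat.le_add_right _ _
  have hn : n ≤ 3 * numBlocks (q₀ + 2) n := by
    unfold numBlocks
    omega
  have hcls : ∀ c ∈ φ.clauses, ∀ l ∈ c, l.2 < 5 * numBlocks (q₀ + 2) n := fun c hc l hl =>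
    (CNF.lt_of_mem_clauses c hc l hl).trans_le (by omega)
  have hE := (length_encode_gadget_le_pow hφ (by omega) hn).trans (Nat.le_add_right _ (6 * k + 11))
  have hq := le_maxSize_gadget (by omega) hcls
  -- An unsatisfiable formula on which `A` exceeds 7^m steps would be one of the slow instances that
  -- `hfast` excludes.
  obtain ⟨b, t, hb, ht, hle⟩ := hc n φ hE fun hunsat y t ht => by
    by_contra hlt
    refine hfast ⟨_, _, ⟨hP _ _ (isIndependence_gadget (by omega) hcls), hE⟩, by omega, by omega,
      y, t, ht, ?_⟩
    have hα := numMaximal_gadget_le hcls fun v => by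
      rw [Bool.eq_false_iff]
      exact fun hv => hunsat (CNF.satisfiable_iff.2 ⟨v, hv⟩)
    refine (mul_rpow_le_pow (maxSize_gadget_le (by omega) hcls) hα).trans ?_
    exact_mod_cast (not_le.1 hlt).le
  exact ⟨b, t, hb, ht, (Nat.cast_le.2 hle).trans (hK n φ (by omega))⟩

end Main

end MaxListing

theorem mainTheorem10 (hSETH : MaxListing.SETH) :
    MaxListing.ListingLowerBound (fun _ F => MaxListing.IsStronglyAccessible F) ∧
      MaxListing.ListingLowerBound (fun _ F => MaxListing.IsIndependence F) :=
  ⟨MaxListing.listingLowerBound_of_isIndependence hSETH fun _ _ h => h.isStronglyAccessible,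
    MaxListing.listingLowerBound_of_isIndependence hSETH fun _ _ h => h⟩
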